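/- Let $k$ be an algebraically closed field and let $n,d\ge 2$ be integers. Let $d'$ be the largest divisor of $d$ that is relatively prime to the characteristic of $k$ (with $d'=d$ if $\operatorname{char} k=0$). Let $$R=k[s,f,b_{ri},c_{ri}\mid r=0,\dots,n-1;\ i=1,2,3,4],$$ a polynomial ring in $8n+2$ variables. The shortened Mayr–Meyer ideal $J=J(n,d)$ is the ideal of $R$ generated by the following polynomials, where an empty product of the form $c_{01}\cdots c_{-1,1}$ is $1$: - $h_{0i}=c_{0i}(s-fb_{0i}^d)$ for $i=1,\dots,4$; - $h_{13}=fc_{01}-sc_{02}$, $\ h_{14}=fc_{04}-sc_{03}$, $\ h_{15}=s(c_{03}-c_{02})$, $\ h_{16}=f(c_{02}b_{01}-c_{03}b_{04})$, and $h_{1,6+i}=fc_{02}c_{1i}(b_{02}-b_{1i}b_{03})$ for $i=1,\dots,4$; - for $r=2,\dots,n$: $h_{r3}=sc_{01}c_{11}\cdots c_{r-3,1}(c_{r-2,4}c_{r-1,1}-c_{r-2,1}c_{r-1,2})$, $h_{r4}=sc_{01}c_{11}\cdots c_{r-3,1}(c_{r-2,4}c_{r-1,4}-c_{r-2,1}c_{r-1,3})$,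 $h_{r5}=sc_{01}c_{11}\cdots c_{r-2,1}(c_{r-1,3}-c_{r-1,2})$, $h_{r6}=sc_{01}c_{11}\cdots c_{r-3,1}c_{r-2,4}(c_{r-1,2}b_{r-1,1}-c_{r-1,3}b_{r-1,4})$; - for $r=2,\dots,n-1$ and $i=1,\dots,4$: $h_{r,6+i}=sc_{01}c_{11}\cdots c_{r-3,1}c_{r-2,4}c_{r-1,2}c_{ri}(b_{r-1,2}-b_{ri}b_{r-1,3})$; - $h_{n7}=sc_{01}c_{11}\cdots c_{n-3,1}c_{n-2,4}c_{n-1,2}(b_{n-1,2}-b_{n-1,3})$. Define the ideals of $R$ $$\begin{aligned} E&=(s-fb_{01}^d,\ b_{01}-b_{04},\ b_{02}^d-b_{03}^d,\ b_{01}^d-b_{02}^d),\\ F&=(b_{02}-b_{11}b_{03},\ b_{14}-b_{11},\ b_{13}-b_{11},\ b_{12}-b_{11},\ b_{12}^d-1),\\ C_r&=(c_{r1},c_{r2},c_{r3},c_{r4})\ \ (0\le r\le n-1),\qquad C_n=(0),\\ D_0&=(c_{04}-c_{01},\ c_{03}-c_{02},\ c_{01}-c_{02}b_{01}^d),\\ D_r&=(c_{r4}-c_{r1},\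 c_{r3}-c_{r2},\ c_{r2}-c_{r1})\ \ (1\le r\le n-1),\\ B_1&=(0),\qquad B_r=(1-b_{2i},\dots,1-b_{ri}\mid i=1,\dots,4)\ \ (2\le r\le n-1),\\ p_1&=C_1+E+D_0,\\ p_r&=C_r+E+F+B_{r-1}+D_0+D_1+\cdots+D_{r-1}\ \ (2\le r\le n). \end{aligned}$$ Then the minimal primes over $J$ are exactly the following ideals: $$\begin{aligned} P_0&=(c_{01},c_{02},c_{03},c_{04}),\\ P_{1\alpha\beta}&=p_1+(b_{01}-\alpha b_{02},\ b_{02}-\beta b_{03}),\\ P_{r\alpha\beta}&=p_r+(b_{01}-\alpha b_{02},\ b_{02}-\beta b_{03},\ \beta-b_{1i}\mid i=1,\dots,4)\ \ (2\le r\le n),\\ P_{-1}&=(s,f),\\ P_{-2}&=(s,c_{01},c_{02},c_{04},b_{03},b_{04}),\\ P_{-3}&=(s,c_{01},c_{04},b_{02},b_{03},\ c_{02}b_{01}-c_{03}b_{04}),\\ P_{-4\Lambda}&=(c_{1i}\mid i\notin\Lambda)+(b_{1i}\mid i\in\Lambda)+(s,c_{01},c_{03},c_{04},b_{01},b_{02}),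 \end{aligned}$$ where $\alpha$ and $\beta$ range over the $d'$-th roots of unity in $k$ and $\Lambda$ ranges over the subsets of $\{1,2,3,4\}$. There are exactly $n(d')^2+20$ of them, and no two distinct ones are comparable by inclusion. -/

import Mathlib

namespace MayrMeyer

/-- The `8n+2` variables `s, f, b_{ri}, c_{ri}` with `r = 0, …, n-1` and `i = 1, 2, 3, 4`.
The second subscript `i ∈ {1, 2, 3, 4}` is recorded as an element of `Fin 4` (integers mod `4`):
the numerals `1, 2, 3, 4` denote its four distinct elements, where `4` is the same as `0`. -/
inductive Var (n : ℕ) : Type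
  | s : Var n
  | f : Var n
  | b (r : Fin n) (i : Fin 4) : Var n
  | c (r : Fin n) (i : Fin 4) : Var n

/-- The polynomial ring `R = k[s, f, b_{ri}, c_{ri}]`. -/
abbrev R (k : Type*) [Field k] (n : ℕ) : Type _ := MvPolynomial (Var n) k

noncomputable section

variable {k : Type*} [Field k] {n : ℕ}

/-- The variable `s`. -/
def s : R k n := MvPolynomial.X Var.s

/-- The variable `f`. -/
def f : R k n := MvPolynomial.X Var.f

/-- The variable `b_{ri}`, for `r < n` (the value `0` for `r ≥ n` is never used). -/
def b (r : ℕ) (i : Fin 4) : R k n :=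
  if h : r < n then MvPolynomial.X (Var.b ⟨r, h⟩ i) else 0

/-- The variable `c_{ri}`, for `r < n` (the value `0` for `r ≥ n` is never used). -/
def c (r : ℕ) (i : Fin 4) : R k n :=
  if h : r < n then MvPolynomial.X (Var.c ⟨r, h⟩ i) else 0

/-- The product `c_{01} c_{11} ⋯ c_{m-1,1}` of `m` variables (equal to `1` if `m = 0`). -/
def cProd (m : ℕ) : R k n := ∏ j ∈ Finset.range m, c j 1

/-- The four level `0` generators `h_{0i}`. -/
def level0 (d : ℕ) : Set (R k n) :=
  {h | ∃ i : Fin 4, h = c 0 i * (s - f * b 0 i ^ d)}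

/-- The eight level `1` generators `h_{13}, …, h_{16}` and `h_{1,6+i}`. -/
def level1 : Set (R k n) :=
  {f * c 0 1 - s * c 0 2,
    f * c 0 4 - s * c 0 3,
    s * (c 0 3 - c 0 2),
    f * (c 0 2 * b 0 1 - c 0 3 * b 0 4)} ∪
  {h | ∃ i : Fin 4, h = f * c 0 2 * c 1 i * (b 0 2 - b 1 i * b 0 3)}

/-- The generators `h_{r3}, h_{r4}, h_{r5}, h_{r6}` of a level `r ≥ 2`. -/
def levelFirst (r : ℕ) : Set (R k n) :=
  {s * cProd (r - 2) * (c (r - 2) 4 * c (r - 1) 1 - c (r - 2) 1 * c (r - 1) 2),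
    s * cProd (r - 2) * (c (r - 2) 4 * c (r - 1) 4 - c (r - 2) 1 * c (r - 1) 3),
    s * cProd (r - 1) * (c (r - 1) 3 - c (r - 1) 2),
    s * cProd (r - 2) * c (r - 2) 4 * (c (r - 1) 2 * b (r - 1) 1 - c (r - 1) 3 * b (r - 1) 4)}

/-- The generators `h_{r,6+i}` of a level `r` with `2 ≤ r ≤ n - 1`. -/
def levelLast (r : ℕ) : Set (R k n) :=
  {h | ∃ i : Fin 4, h = s * cProd (r - 2) * c (r - 2) 4 * c (r - 1) 2 * c r i *
    (b (r - 1) 2 - b r i * b (r - 1) 3)}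

variable (k n) in
/-- The shortened Mayr–Meyer ideal `J(n,d)`, for `n ≥ 2`; the last generator is `h_{n7}`. -/
def J (d : ℕ) : Ideal (R k n) :=
  Ideal.span
    (level0 d ∪ level1 ∪
      {h | ∃ r : ℕ, 2 ≤ r ∧ r ≤ n ∧ h ∈ levelFirst r} ∪
      {h | ∃ r : ℕ, 2 ≤ r ∧ r < n ∧ h ∈ levelLast r} ∪
      {s * cProd (n - 2) * c (n - 2) 4 * c (n - 1) 2 * (b (n - 1) 2 - b (n - 1) 3)})

/-- The ideal `E`. -/
def idealE (d : ℕ) : Ideal (R k n) :=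
  Ideal.span {s - f * b 0 1 ^ d} +
    Ideal.span {b 0 1 - b 0 4, b 0 2 ^ d - b 0 3 ^ d, b 0 1 ^ d - b 0 2 ^ d}

/-- The ideal `F`. -/
def idealF (d : ℕ) : Ideal (R k n) :=
  Ideal.span {b 0 2 - b 1 1 * b 0 3, b 1 4 - b 1 1, b 1 3 - b 1 1, b 1 2 - b 1 1, b 1 2 ^ d - 1}

/-- The ideals `C_0, …, C_{n-1}`, and `C_n = (0)`. -/
def idealC (r : ℕ) : Ideal (R k n) :=
  if r < n then Ideal.span {c r 1, c r 2, c r 3, c r 4} else ⊥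

/-- The ideals `D_0, …, D_{n-1}`; here `D_0` depends on `d`. -/
def idealD (d r : ℕ) : Ideal (R k n) :=
  if r = 0 then Ideal.span {c 0 4 - c 0 1, c 0 3 - c 0 2, c 0 1 - c 0 2 * b 0 1 ^ d}
  else Ideal.span {c r 4 - c r 1, c r 3 - c r 2, c r 2 - c r 1}

/-- The ideals `B_0 = B_1 = (0)` and `B_r = (1 - b_{2i}, …, 1 - b_{ri} | i = 1, …, 4)`. -/
def idealB (r : ℕ) : Ideal (R k n) :=
  Ideal.span {x | ∃ (j : ℕ) (i : Fin 4), 2 ≤ j ∧ j ≤ r ∧ x = 1 - b j i}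

/-- The ideals `p_r`, `1 ≤ r ≤ n`. -/
def p (d r : ℕ) : Ideal (R k n) :=
  if r = 1 then idealC 1 + idealE d + idealD d 0
  else idealC r + idealE d + idealF d + idealB (r - 1) + ∑ j ∈ Finset.range r, idealD d j

/-- The prime `P_0`. -/
def P0 : Ideal (R k n) := Ideal.span {c 0 1, c 0 2, c 0 3, c 0 4}

/-- The primes `P_{rαβ}`, `1 ≤ r ≤ n`. -/
def Pr (d r : ℕ) (α β : k) : Ideal (R k n) :=
  if r = 1 then
    p d 1 + Ideal.span {b 0 1 - MvPolynomial.C α * b 0 2, b 0 2 - MvPolynomial.C β * b 0 3}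
  else
    p d r + Ideal.span
      ({b 0 1 - MvPolynomial.C α * b 0 2, b 0 2 - MvPolynomial.C β * b 0 3} ∪
        {x | ∃ i : Fin 4, x = MvPolynomial.C β - b 1 i})

/-- The prime `P_{-1}`. -/
def Pneg1 : Ideal (R k n) := Ideal.span {s, f}

/-- The prime `P_{-2}`. -/
def Pneg2 : Ideal (R k n) := Ideal.span {s, c 0 1, c 0 2, c 0 4, b 0 3, b 0 4}

/-- The prime `P_{-3}`. -/
def Pneg3 : Ideal (R k n) :=
  Ideal.span {s, c 0 1, c 0 4, b 0 2, b 0 3, c 0 2 * b 0 1 - c 0 3 * b 0 4}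

/-- The primes `P_{-4Λ}`, for `Λ ⊆ {1, 2, 3, 4}`. -/
def Pneg4 (Λ : Finset (Fin 4)) : Ideal (R k n) :=
  Ideal.span {x | ∃ i : Fin 4, i ∉ Λ ∧ x = c 1 i} +
    Ideal.span {x | ∃ i : Fin 4, i ∈ Λ ∧ x = b 1 i} +
    Ideal.span {s, c 0 1, c 0 3, c 0 4, b 0 1, b 0 2}

variable (k n) in
/-- The primes `P_0` and `P_{rαβ}`, where `1 ≤ r ≤ n` and `α, β` are `d'`-th roots of unity. -/
def primesWithoutSF (d d' : ℕ) : Set (Ideal (R k n)) :=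
  {P0} ∪ {P | ∃ (r : ℕ) (α β : k),
    1 ≤ r ∧ r ≤ n ∧ α ^ d' = 1 ∧ β ^ d' = 1 ∧ P = Pr d r α β}

variable (k n) in
/-- The primes `P_{-1}`, `P_{-2}`, `P_{-3}` and `P_{-4Λ}`. -/
def primesWithS : Set (Ideal (R k n)) :=
  {Pneg1, Pneg2, Pneg3} ∪ {P | ∃ Λ : Finset (Fin 4), P = Pneg4 Λ}

variable (k n) in
/-- All the listed primes. -/
def listedPrimes (d d' : ℕ) : Set (Ideal (R k n)) :=
  primesWithoutSF k n d d' ∪ primesWithS k n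

variable (k) in
/-- `d'` is the largest divisor of `d` prime to the characteristic of `k`; in characteristic
zero there is no restriction, so that `d' = d`. -/
def IsPrimeToCharPart (d d' : ℕ) : Prop :=
  IsGreatest {m : ℕ | m ∣ d ∧ (ringChar k ≠ 0 → Nat.Coprime m (ringChar k))} d'

end

end MayrMeyer

/-! An ideal given by generators lies in the kernel of a homomorphism `ψ` exactly when the images of
the variables satisfy the corresponding equations. Everything is therefore done by solving
equations, with `ψ` a quotient map, a substitution, or evaluation at a `k`-point.

Covering (`exists_listedPrimes_le`): let `P` be a prime over `J` and work in the domain `R/P`. If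
all `c_{0i}` vanish, then `P` contains `P_0`. If `s = 0`, only levels 0 and 1 impose conditions, and
a short case analysis yields `P_0` or one of the primes with negative index. Otherwise let `r ≥ 1`
be the first level on which all `c_{ri}` vanish, with `c_n = 0` by convention. Below level `r`
everything can be cancelled: the `c`'s agree within each positive level, the `b_{0i}` have equal
`d`-th powers and so differ by `d'`-th roots of unity `α`, `β`, and the remaining relations force
`b_{1i} = β` and `b_{ji} = 1` for `2 ≤ j < r`. Thus `P` contains `P_{rαβ}`.

Conversely each listed ideal contains `J` (`J_le_primeFamily`) and is prime (`isPrime_primeFamily`),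
by eliminating variables; only `P_{-3}` needs more, the irreducibility of a quadric.

Finally, each listed prime has a `k`-rational zero lying on no other listed prime
(`exists_separating_point`). This gives both incomparability and distinctness, hence minimality and
the count (`natCard_primeIndex`). -/

namespace MayrMeyer

/-! ### Roots of unity and the prime-to-characteristic part of `d`. -/

section Roots

/-- `d` is the product of `d'` and a power of the characteristic exponent. -/
lemma IsPrimeToCharPart.exists_eq_mul_pow {k : Type*} [Field k] {d d' : ℕ} (hd : d ≠ 0)
    (h : IsPrimeToCharPart k d d') : ∃ e : ℕ, d = d' * ringExpChar k ^ e := by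
  obtain ⟨⟨hdvd, hcop⟩, hmax⟩ := h
  rcases CharP.exists' k with h0 | ⟨p, hp, hchar⟩
  · have h1 : ringChar k = 0 := ringChar.eq_zero
    have hle : d ≤ d' := hmax ⟨dvd_rfl, fun h ↦ absurd h1 h⟩
    exact ⟨0, by simpa using le_antisymm hle (Nat.le_of_dvd (Nat.pos_of_ne_zero hd) hdvd)⟩
  · have h1 : ringChar k = p := ringChar.eq k p
    have hp1 : p.Prime := hp.out
    obtain ⟨e, m, hm, rfl⟩ := Nat.exists_eq_pow_mul_and_not_dvd hd p hp1.ne_one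
    have hmc : m.Coprime p := ((Nat.Prime.coprime_iff_not_dvd hp1).2 hm).symm
    have hle : m ≤ d' := hmax ⟨dvd_mul_left _ _, fun _ ↦ h1 ▸ hmc⟩
    have hd'c : d'.Coprime p := h1 ▸ hcop (h1 ▸ hp1.ne_zero)
    -- The `p`-free part `m` of `d` is itself an admissible divisor, so `m ≤ d'`; conversely `d'`
    -- divides `p ^ e * m` and is prime to `p`.
    have hdm : d' ∣ m := (Nat.Coprime.pow_right e hd'c).dvd_of_dvd_mul_left hdvd
    have hm0 : 0 < m := Nat.pos_of_ne_zero fun h0 ↦ hm (h0 ▸ dvd_zero p)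
    have hmd : m = d' := le_antisymm hle (Nat.le_of_dvd hm0 hdm)
    refine ⟨e, ?_⟩
    have : ringExpChar k = p := by
      rw [ringExpChar, h1]; exact max_eq_left hp1.one_lt.le
    rw [this, hmd, mul_comm]

/-- This is what provides a primitive `d'`-th root of unity, and with it the exact number of roots.
-/
lemma IsPrimeToCharPart.cast_ne_zero {k : Type*} [Field k] {d d' : ℕ} (hd : d ≠ 0)
    (h : IsPrimeToCharPart k d d') : (d' : k) ≠ 0 := by
  obtain ⟨⟨hdvd, hcop⟩, -⟩ := h
  intro h0
  rw [ringChar.spec] at h0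
  have hd'0 : d' ≠ 0 := fun h ↦ hd (by simpa [h] using hdvd)
  have h1 : ringChar k ≠ 0 := fun h ↦ hd'0 (by simpa [h] using h0)
  have := Nat.Coprime.eq_one_of_dvd (hcop h1).symm h0
  exact CharP.ringChar_ne_one this

variable {k : Type*} [Field k] [IsAlgClosed k] {A : Type*} [CommRing A] [IsDomain A]

lemma exists_isPrimitiveRoot {m : ℕ} (hm : (m : k) ≠ 0) : ∃ ζ : k, IsPrimitiveRoot ζ m :=
  haveI : NeZero (m : k) := ⟨hm⟩
  HasEnoughRootsOfUnity.exists_primitiveRoot k m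

/-- In a domain over an algebraically closed field, elements with the same `d`-th power differ by
a `d'`-th root of unity of the field. -/
lemma IsPrimeToCharPart.exists_eq_mul_of_pow_eq {d d' : ℕ} (hd : d ≠ 0)
    (h : IsPrimeToCharPart k d d') (κ : k →+* A) {x y : A} (hxy : x ^ d = y ^ d) :
    ∃ α : k, α ^ d' = 1 ∧ x = κ α * y := by
  obtain ⟨e, he⟩ := h.exists_eq_mul_pow hd
  have : ExpChar A (ringExpChar k) := expChar_of_injective_ringHom κ.injective _
  have hm := h.cast_ne_zero hd
  have hpos : 0 < d' := Nat.pos_of_ne_zero fun h0 ↦ hm (by simp [h0])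
  have h1 : x ^ d' - y ^ d' = 0 := by
    -- By Frobenius `x ^ d - y ^ d` is a `p ^ e`-th power of `x ^ d' - y ^ d'`, and a domain is
    -- reduced.
    refine eq_zero_of_pow_eq_zero (n := ringExpChar k ^ e) ?_
    rw [sub_pow_expChar_pow, ← pow_mul, ← pow_mul, ← he, hxy, sub_self]
  obtain ⟨ζ, hζ⟩ := exists_isPrimitiveRoot hm
  have hζ' := hζ.map_of_injective κ.injective
  rw [hζ'.pow_sub_pow_eq_prod_sub_mul x y hpos, Finset.prod_eq_zero_iff] at h1
  obtain ⟨ξ, hξ, h2⟩ := h1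
  rw [Polynomial.mem_nthRootsFinset hpos] at hξ
  have : NeZero d' := ⟨hpos.ne'⟩
  obtain ⟨i, -, rfl⟩ := hζ'.eq_pow_of_pow_eq_one hξ
  refine ⟨ζ ^ i, ?_, ?_⟩
  · rw [← pow_mul, mul_comm, pow_mul, hζ.pow_eq_one, one_pow]
  · rw [map_pow]; exact sub_eq_zero.1 h2

end Roots

/-! ### Primality criteria in polynomial rings. -/

section Retract

open MvPolynomial

variable {σ k : Type*} [Field k]

/-- An ideal is prime if it is the preimage of a prime ideal `K` contained in it under an
endomorphism that is the identity modulo the ideal. -/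
lemma isPrime_of_retract (g : σ → MvPolynomial σ k) {I K : Ideal (MvPolynomial σ k)}
    (hK : K.IsPrime) (hKI : K ≤ I) (hI : I ≤ K.comap (aeval g).toRingHom)
    (hX : ∀ v, X v - g v ∈ I) : I.IsPrime := by
  have key : ∀ q : MvPolynomial σ k, q - aeval g q ∈ I := by
    have : (Ideal.Quotient.mkₐ k I).comp (aeval g) = Ideal.Quotient.mkₐ k I := by
      ext v
      simpa using ((Ideal.Quotient.mk_eq_mk_iff_sub_mem _ _).2 (hX v)).symm
    intro q
    rw [← Ideal.Quotient.mk_eq_mk_iff_sub_mem]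
    exact (DFunLike.congr_fun this q).symm
  have : I = K.comap (aeval g).toRingHom := by
    -- If `g` sends `q` into `K ≤ I`, then `q` lies in `I`, because `q` and its image agree modulo
    -- `I`.
    refine le_antisymm hI fun q hq ↦ ?_
    have h1 : aeval g q ∈ I := hKI hq
    simpa using I.add_mem (key q) h1
  rw [this]
  exact hK.comap _

/-- Killing variables outside those occurring in a prime ideal gives a prime ideal. -/
lemma isPrime_span_X_sup (T : Set σ) {K : Ideal (MvPolynomial σ k)} (hK : K.IsPrime)
    (hT : ∀ g : σ → MvPolynomial σ k, (∀ v ∉ T, g v = X v) → K ≤ K.comap (aeval g).toRingHom) :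
    (Ideal.span (X '' T) ⊔ K).IsPrime := by
  classical
  refine isPrime_of_retract (fun v ↦ if v ∈ T then 0 else X v) hK le_sup_right
    (sup_le ?_ (hT _ fun v hv ↦ if_neg hv)) fun v ↦ ?_
  · rw [Ideal.span_le]
    rintro _ ⟨v, hv, rfl⟩
    simp [hv]
  · by_cases hv : v ∈ T
    · simpa [hv] using Ideal.mem_sup_left (Ideal.subset_span (Set.mem_image_of_mem X hv))
    · simp [hv]

lemma isPrime_span_X (T : Set σ) : (Ideal.span (X '' T : Set (MvPolynomial σ k))).IsPrime := by
  simpa using isPrime_span_X_sup (k := k) T (K := ⊥) Ideal.isPrime_bot (fun g _ ↦ bot_le)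

/-- The generic quadric of rank four generates a prime ideal. -/
lemma isPrime_span_quadric {a b c d : σ} (hab : a ≠ b) (hac : a ≠ c) (had : a ≠ d)
    (hbc : b ≠ c) (hbd : b ≠ d) :
    (Ideal.span {X a * X b - X c * X d} : Ideal (MvPolynomial σ k)).IsPrime := by
  classical
  have hirr : Irreducible (X a * X b + -(X c * X d) : MvPolynomial σ k) := by
    -- The quadric has degree one in `X b`, with coprime coefficients `X a` and `-(X c * X d)`.
    refine irreducible_mul_X_add _ _ _ (X_ne_zero a) ?_ ?_ ?_
    · simpa [vars_X] using hab.symm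
    · rw [vars_neg]
      intro h
      simpa [vars_X, hbc, hbd] using vars_mul _ _ h
    · rw [(X_prime).irreducible.isRelPrime_iff_not_dvd, dvd_neg]
      intro h
      rcases (X_prime).dvd_or_dvd h with h | h <;> rw [X_dvd_X] at h
      · exact hac h
      · exact had h
  rw [sub_eq_add_neg]
  exact (Ideal.span_singleton_prime hirr.ne_zero).2 hirr.prime

end Retract

end MayrMeyer
namespace MayrMeyer

/-! ### Substitution homomorphisms. -/

section Equations

variable {k : Type*} [Field k] {n : ℕ} {A : Type*} [CommRing A]

lemma forall_fin_four {q : Fin 4 → Prop} : (∀ i, q i) ↔ q 1 ∧ q 2 ∧ q 3 ∧ q 4 :=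
  ⟨fun h ↦ ⟨h 1, h 2, h 3, h 4⟩, fun ⟨h1, h2, h3, h4⟩ i ↦ by fin_cases i <;> assumption⟩

/-- The homomorphism sending the variables to given values. -/
noncomputable def evalAt [Algebra k A] (s₀ f₀ : A) (b₀ c₀ : ℕ → Fin 4 → A) : R k n →ₐ[k] A :=
  MvPolynomial.aeval fun
    | .s => s₀
    | .f => f₀
    | .b r i => b₀ r i
    | .c r i => c₀ r i

variable [Algebra k A] (s₀ f₀ : A) (b₀ c₀ : ℕ → Fin 4 → A)

@[simp] lemma evalAt_s : evalAt (k := k) (n := n) s₀ f₀ b₀ c₀ s = s₀ := by simp [evalAt, s]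

@[simp] lemma evalAt_f : evalAt (k := k) (n := n) s₀ f₀ b₀ c₀ f = f₀ := by simp [evalAt, f]

lemma evalAt_b {r : ℕ} (hr : r < n) (i : Fin 4) :
    evalAt (k := k) (n := n) s₀ f₀ b₀ c₀ (b r i) = b₀ r i := by simp [evalAt, b, hr]

lemma evalAt_c {r : ℕ} (hr : r < n) (i : Fin 4) :
    evalAt (k := k) (n := n) s₀ f₀ b₀ c₀ (c r i) = c₀ r i := by simp [evalAt, c, hr]

@[simp] lemma evalAt_C (a : k) :
    evalAt (k := k) (n := n) s₀ f₀ b₀ c₀ (MvPolynomial.C a) = algebraMap k A a := by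
  simp [evalAt]

/-- The default value plays the role of `C_n = (0)`: level `n` counts as vanishing, so `r = n` needs
no separate treatment. -/
lemma c_self (i : Fin 4) : (c n i : R k n) = 0 := by simp [c]

end Equations

/-! ### Equations for `P_{rαβ}`. -/

section PrEquations

variable {k : Type*} [Field k] {n : ℕ} {A : Type*} [CommRing A]

/-- The equations expressing that a homomorphism `ψ` vanishes on `P_{rαβ}`. -/
structure VanishesOnPr (d r : ℕ) (α β : k) (ψ : R k n →+* A) : Prop where
  s_eq : ψ s = ψ f * ψ (b 0 3) ^ d
  b02 : ψ (b 0 2) = ψ (MvPolynomial.C β) * ψ (b 0 3)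
  b01 : ψ (b 0 1) = ψ (MvPolynomial.C α) * ψ (b 0 2)
  b04 : ψ (b 0 4) = ψ (b 0 1)
  c01 : ψ (c 0 1) = ψ (c 0 2) * ψ (b 0 3) ^ d
  c03 : ψ (c 0 3) = ψ (c 0 2)
  c04 : ψ (c 0 4) = ψ (c 0 1)
  c_zero : ∀ i, ψ (c r i) = 0
  c_eq : ∀ j i, 1 ≤ j → j < r → ψ (c j i) = ψ (c j 1)
  b_one : ∀ j i, 2 ≤ j → j < r → ψ (b j i) = 1
  b_beta : 2 ≤ r → ∀ i, ψ (b 1 i) = ψ (MvPolynomial.C β)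

lemma map_pow_b01 {ψ : R k n →+* A} {d : ℕ} {α β : k} (hα : α ^ d = 1) (hβ : β ^ d = 1)
    (h2 : ψ (b 0 2) = ψ (MvPolynomial.C β) * ψ (b 0 3))
    (h1 : ψ (b 0 1) = ψ (MvPolynomial.C α) * ψ (b 0 2)) :
    ψ (b 0 2) ^ d = ψ (b 0 3) ^ d ∧ ψ (b 0 1) ^ d = ψ (b 0 3) ^ d := by
  have e1 : ψ (MvPolynomial.C α) ^ d = 1 := by rw [← map_pow, ← map_pow, hα, map_one, map_one]
  have e2 : ψ (MvPolynomial.C β) ^ d = 1 := by rw [← map_pow, ← map_pow, hβ, map_one, map_one]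
  rw [h1, h2, mul_pow, mul_pow, mul_pow, e1, e2]; simp

lemma idealC_le_ker {ψ : R k n →+* A} {r : ℕ} (hr : r ≤ n) :
    idealC r ≤ RingHom.ker ψ ↔ ∀ i, ψ (c r i) = 0 := by
  rcases hr.lt_or_eq with h | rfl
  · rw [forall_fin_four]
    simp [idealC, h, Ideal.span_le, Set.insert_subset_iff]
  · simp [idealC, c_self]

lemma idealD_le_ker {ψ : R k n →+* A} {d r : ℕ} (hr : 1 ≤ r) :
    idealD d r ≤ RingHom.ker ψ ↔ ∀ i, ψ (c r i) = ψ (c r 1) := by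
  rw [forall_fin_four]
  simp only [idealD, if_neg (Nat.one_le_iff_ne_zero.1 hr), Ideal.span_le, Set.insert_subset_iff,
    Set.singleton_subset_iff, SetLike.mem_coe, RingHom.mem_ker, map_sub, sub_eq_zero]
  exact ⟨fun ⟨h4, h3, h2⟩ ↦ ⟨trivial, h2, h3.trans h2, h4⟩,
    fun ⟨_, h2, h3, h4⟩ ↦ ⟨h4, h3.trans h2.symm, h2⟩⟩

lemma idealD_zero_le_ker {ψ : R k n →+* A} {d : ℕ} :
    idealD d 0 ≤ RingHom.ker ψ ↔ ψ (c 0 4) = ψ (c 0 1) ∧ ψ (c 0 3) = ψ (c 0 2) ∧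
      ψ (c 0 1) = ψ (c 0 2) * ψ (b 0 1) ^ d := by
  simp only [idealD, if_true, Ideal.span_le, Set.insert_subset_iff,
    Set.singleton_subset_iff, SetLike.mem_coe, RingHom.mem_ker, map_sub, sub_eq_zero, map_mul,
    map_pow]

lemma idealE_le_ker {ψ : R k n →+* A} {d : ℕ} :
    idealE d ≤ RingHom.ker ψ ↔ ψ s = ψ f * ψ (b 0 1) ^ d ∧ ψ (b 0 1) = ψ (b 0 4) ∧
      ψ (b 0 2) ^ d = ψ (b 0 3) ^ d ∧ ψ (b 0 1) ^ d = ψ (b 0 2) ^ d := by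
  simp only [idealE, Submodule.add_eq_sup, sup_le_iff, Ideal.span_le, Set.insert_subset_iff,
    Set.singleton_subset_iff, SetLike.mem_coe, RingHom.mem_ker, map_sub, sub_eq_zero, map_mul,
    map_pow]

lemma idealF_le_ker {ψ : R k n →+* A} {d : ℕ} :
    idealF d ≤ RingHom.ker ψ ↔ ψ (b 0 2) = ψ (b 1 1) * ψ (b 0 3) ∧ ψ (b 1 4) = ψ (b 1 1) ∧
      ψ (b 1 3) = ψ (b 1 1) ∧ ψ (b 1 2) = ψ (b 1 1) ∧ ψ (b 1 2) ^ d = 1 := by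
  simp only [idealF, Ideal.span_le, Set.insert_subset_iff,
    Set.singleton_subset_iff, SetLike.mem_coe, RingHom.mem_ker, map_sub, sub_eq_zero, map_mul,
    map_pow, map_one]

lemma idealB_le_ker {ψ : R k n →+* A} {r : ℕ} :
    idealB r ≤ RingHom.ker ψ ↔ ∀ j i, 2 ≤ j → j ≤ r → ψ (b j i) = 1 := by
  rw [idealB, Ideal.span_le]
  constructor
  · intro h j i h2 hr
    have := h ⟨j, i, h2, hr, rfl⟩
    simp only [SetLike.mem_coe, RingHom.mem_ker, map_sub, map_one, sub_eq_zero] at this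
    exact this.symm
  · rintro h _ ⟨j, i, h2, hr, rfl⟩
    simp [h j i h2 hr]

lemma sum_le_iff {ι S : Type*} [CommRing S] (t : Finset ι) (I : ι → Ideal S) (K : Ideal S) :
    ∑ j ∈ t, I j ≤ K ↔ ∀ j ∈ t, I j ≤ K := by
  simp [Ideal.sum_eq_sup]

/-- Since `α` and `β` are `d`-th roots of unity, the linear relations imply the `d`-th power
relations of `E` and `F`. What remains is a triangular system, each equation solving for one
variable. -/
lemma Pr_le_ker {ψ : R k n →+* A} {d r : ℕ} (hr1 : 1 ≤ r) (hr : r ≤ n) {α β : k}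
    (hα : α ^ d = 1) (hβ : β ^ d = 1) :
    Pr d r α β ≤ RingHom.ker ψ ↔ VanishesOnPr d r α β ψ := by
  have hβ' : ψ (MvPolynomial.C β) ^ d = 1 := by rw [← map_pow, ← map_pow, hβ, map_one, map_one]
  have hspan2 : Ideal.span {b 0 1 - MvPolynomial.C α * b 0 2, b 0 2 - MvPolynomial.C β * b 0 3} ≤
      RingHom.ker ψ ↔ ψ (b 0 1) = ψ (MvPolynomial.C α) * ψ (b 0 2) ∧
        ψ (b 0 2) = ψ (MvPolynomial.C β) * ψ (b 0 3) := by
    simp only [Ideal.span_le, Set.insert_subset_iff,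
      Set.singleton_subset_iff, SetLike.mem_coe, RingHom.mem_ker, map_sub, sub_eq_zero, map_mul]
  have hspanb : Ideal.span {x | ∃ i : Fin 4, x = MvPolynomial.C β - b 1 i} ≤
      RingHom.ker ψ ↔ ∀ i, ψ (b 1 i) = ψ (MvPolynomial.C β) := by
    rw [Ideal.span_le]
    constructor
    · intro h i
      have := h ⟨i, rfl⟩
      simp only [SetLike.mem_coe, RingHom.mem_ker, map_sub, sub_eq_zero] at this
      exact this.symm
    · rintro h _ ⟨i, rfl⟩
      simp [h]
  by_cases h1 : r = 1
  · subst h1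
    simp only [Pr, p, if_true, Submodule.add_eq_sup, sup_le_iff, hspan2, idealC_le_ker hr,
      idealE_le_ker, idealD_zero_le_ker]
    constructor
    · rintro ⟨⟨⟨hC, hs, h4, -, -⟩, hc4, hc3, hc1⟩, hb1, hb2⟩
      have hp := map_pow_b01 hα hβ hb2 hb1
      exact ⟨hp.2 ▸ hs, hb2, hb1, h4.symm, hp.2 ▸ hc1, hc3, hc4, hC, fun j i h h' ↦ by omega,
        fun j i h h' ↦ by omega, fun h ↦ by omega⟩
    · intro h
      have hp := map_pow_b01 hα hβ h.b02 h.b01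
      exact ⟨⟨⟨h.c_zero, by rw [hp.2, h.s_eq], h.b04.symm, hp.1, hp.2.trans hp.1.symm⟩,
        h.c04, h.c03, by rw [hp.2, h.c01]⟩, h.b01, h.b02⟩
  · have h2 : 2 ≤ r := by omega
    simp only [Pr, p, if_neg h1, Submodule.add_eq_sup, sup_le_iff, Ideal.span_union, hspan2,
      hspanb, idealC_le_ker hr, idealE_le_ker, idealF_le_ker, idealB_le_ker, sum_le_iff,
      Finset.mem_range]
    constructor
    · rintro ⟨⟨⟨⟨⟨hC, hs, h4, -, -⟩, -⟩, hB⟩, hD⟩, ⟨hb1, hb2⟩, hb⟩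
      have hp := map_pow_b01 hα hβ hb2 hb1
      obtain ⟨hc4, hc3, hc1⟩ := idealD_zero_le_ker.1 (hD 0 (by omega))
      exact ⟨hp.2 ▸ hs, hb2, hb1, h4.symm, hp.2 ▸ hc1, hc3, hc4, hC,
        fun j i h h' ↦ (idealD_le_ker h).1 (hD j h') i,
        fun j i h h' ↦ hB j i h (by omega), fun _ ↦ hb⟩
    · intro h
      have hp := map_pow_b01 hα hβ h.b02 h.b01
      have hb := h.b_beta h2
      refine ⟨⟨⟨⟨⟨h.c_zero, by rw [hp.2, h.s_eq], h.b04.symm, hp.1, hp.2.trans hp.1.symm⟩, ?_⟩,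
        fun j i hj hj' ↦ h.b_one j i hj (by omega)⟩, fun j hj ↦ ?_⟩, ⟨h.b01, h.b02⟩, hb⟩
      · simp only [hb, hβ', h.b02, and_self]
      · rcases Nat.eq_zero_or_pos j with rfl | hj0
        · exact idealD_zero_le_ker.2 ⟨h.c04, h.c03, by rw [hp.2, h.c01]⟩
        · exact (idealD_le_ker hj0).2 fun i ↦ h.c_eq j i hj0 hj

end PrEquations

/-! ### Primality of the listed ideals. -/

section Primality

open MvPolynomial

variable {k : Type*} [Field k] {n : ℕ}

lemma isPrime_Pr {d r : ℕ} (hn : 2 ≤ n) (hr1 : 1 ≤ r) (hr : r ≤ n) {α β : k}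
    (hα : α ^ d = 1) (hβ : β ^ d = 1) : (Pr d r α β : Ideal (R k n)).IsPrime := by
  have hmk : VanishesOnPr d r α β (Ideal.Quotient.mk (Pr d r α β : Ideal (R k n))) :=
    (Pr_le_ker hr1 hr hα hβ).1 (by rw [Ideal.mk_ker])
  -- The triangular system is solved in terms of the free variables: `f`, `b_{03}`, `c_{02}`,
  -- `c_{j1}` for `1 ≤ j < r`, all `b` of positive level at least `r`, and all `c` of level above
  -- `r`.
  let bv : ℕ → Fin 4 → R k n := fun j i ↦
    if j = 0 then (if i = 3 then b 0 3 else if i = 2 then C β * b 0 3 else C α * (C β * b 0 3))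
    else if j < r then (if j = 1 then C β else 1) else b j i
  let cv : ℕ → Fin 4 → R k n := fun j i ↦
    if j = 0 then (if i = 2 ∨ i = 3 then c 0 2 else c 0 2 * b 0 3 ^ d)
    else if j < r then c j 1 else if j = r then 0 else c j i
  refine isPrime_of_retract (fun
    | .s => f * b 0 3 ^ d
    | .f => f
    | .b r i => bv r i
    | .c r i => cv r i) (K := ⊥) Ideal.isPrime_bot bot_le ?_ ?_
  · change Pr d r α β ≤ RingHom.ker (evalAt (k := k) (f * b 0 3 ^ d) f bv cv).toRingHom
    rw [Pr_le_ker hr1 hr hα hβ]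
    have h0 : 0 < n := by omega
    constructor <;> simp only [AlgHom.toRingHom_eq_coe, RingHom.coe_coe, evalAt_s, evalAt_f,
      evalAt_C, evalAt_b _ _ _ _ h0, evalAt_c _ _ _ _ h0, algebraMap_eq]
    any_goals simp [bv, cv]; done
    · intro i
      rcases hr.lt_or_eq with h | rfl
      · rw [evalAt_c _ _ _ _ h]; simp [cv, Nat.one_le_iff_ne_zero.1 hr1]
      · simp [c_self]
    · intro j i h1 h2
      rw [evalAt_c _ _ _ _ (h2.trans_le hr), evalAt_c _ _ _ _ (h2.trans_le hr)]
      simp [cv, Nat.one_le_iff_ne_zero.1 h1, h2]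
    · intro j i h1 h2
      rw [evalAt_b _ _ _ _ (h2.trans_le hr)]
      simp [bv, h2, show j ≠ 0 by omega, show j ≠ 1 by omega]
    · intro h2 i
      rw [evalAt_b _ _ _ _ (by omega)]
      simp [bv, show 1 < r by omega]
  · rintro (_ | _ | ⟨⟨j, hj⟩, i⟩ | ⟨⟨j, hj⟩, i⟩) <;>
      rw [← Ideal.Quotient.mk_eq_mk_iff_sub_mem]
    · simpa [s] using hmk.s_eq
    · rfl
    · have hbX : (X (Var.b ⟨j, hj⟩ i) : R k n) = b j i := by simp [b, hj]
      rw [hbX]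
      simp only [bv]
      split_ifs with h1 h2 h3 h4 h5
      · rw [h1, h2]
      · rw [h1, h3, hmk.b02, map_mul]
      · rw [map_mul, map_mul, ← hmk.b02, ← hmk.b01, h1]
        revert h2 h3
        -- The first case is `0`, which is the index `4`.
        fin_cases i
        · intros; exact hmk.b04
        · intros; rfl
        · intro _ h; exact absurd rfl h
        · intro h; exact absurd rfl h
      · rw [h5, hmk.b_beta (by omega)]
      · rw [hmk.b_one j i (by omega) h4, map_one]
      · rfl
    · have hcX : (X (Var.c ⟨j, hj⟩ i) : R k n) = c j i := by simp [c, hj]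
      rw [hcX]
      simp only [cv]
      split_ifs with h1 h2 h3 h4
      · rcases h2 with rfl | rfl
        · rw [h1]
        · rw [h1, hmk.c03]
      · rw [map_mul, map_pow, ← hmk.c01, h1]
        revert h2
        fin_cases i
        · intros; exact hmk.c04
        · intros; rfl
        · intro h; exact absurd (Or.inl rfl) h
        · intro h; exact absurd (Or.inr rfl) h
      · exact hmk.c_eq j i (by omega) h3
      · rw [h4, hmk.c_zero, map_zero]
      · rfl

lemma b_of_lt {r : ℕ} (hr : r < n) (i : Fin 4) : (b r i : R k n) = X (Var.b ⟨r, hr⟩ i) :=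
  dif_pos hr

lemma c_of_lt {r : ℕ} (hr : r < n) (i : Fin 4) : (c r i : R k n) = X (Var.c ⟨r, hr⟩ i) :=
  dif_pos hr

lemma isPrime_P0 (hn : 2 ≤ n) : (P0 : Ideal (R k n)).IsPrime := by
  have h0 : 0 < n := by omega
  simpa only [Set.image_insert_eq, Set.image_singleton, P0, c_of_lt h0] using isPrime_span_X (k := k)
    {Var.c ⟨0, h0⟩ 1, Var.c ⟨0, h0⟩ 2, Var.c ⟨0, h0⟩ 3, Var.c ⟨0, h0⟩ 4}

lemma isPrime_Pneg1 : (Pneg1 : Ideal (R k n)).IsPrime := by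
  simpa only [Set.image_insert_eq, Set.image_singleton, Pneg1, s, f] using
    isPrime_span_X (k := k) {Var.s, Var.f}

lemma isPrime_Pneg2 (hn : 2 ≤ n) : (Pneg2 : Ideal (R k n)).IsPrime := by
  have h0 : 0 < n := by omega
  simpa only [Set.image_insert_eq, Set.image_singleton, Pneg2, s, c_of_lt h0, b_of_lt h0] using
    isPrime_span_X (k := k) {Var.s, Var.c ⟨0, h0⟩ 1, Var.c ⟨0, h0⟩ 2, Var.c ⟨0, h0⟩ 4,
      Var.b ⟨0, h0⟩ 3, Var.b ⟨0, h0⟩ 4}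

lemma isPrime_Pneg3 (hn : 2 ≤ n) : (Pneg3 : Ideal (R k n)).IsPrime := by
  have h0 : 0 < n := by omega
  have hK : (Ideal.span {c 0 2 * b 0 1 - c 0 3 * b 0 4} : Ideal (R k n)).IsPrime := by
    simp only [c_of_lt h0, b_of_lt h0]
    exact isPrime_span_quadric (by simp) (by simp) (by simp) (by simp) (by simp)
  have := isPrime_span_X_sup (k := k) {Var.s, Var.c ⟨0, h0⟩ 1, Var.c ⟨0, h0⟩ 4, Var.b ⟨0, h0⟩ 2,
    Var.b ⟨0, h0⟩ 3} hK (fun g hg ↦ by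
      rw [Ideal.span_singleton_le_iff_mem, Ideal.mem_comap]
      convert Ideal.mem_span_singleton_self _ using 1
      simp [c_of_lt h0, b_of_lt h0, hg])
  rw [← Ideal.span_union] at this
  simpa only [Set.image_insert_eq, Set.image_singleton, Set.insert_union, Set.singleton_union,
    Pneg3, s, c_of_lt h0, b_of_lt h0] using this

lemma isPrime_Pneg4 (hn : 2 ≤ n) (Λ : Finset (Fin 4)) : (Pneg4 Λ : Ideal (R k n)).IsPrime := by
  have h0 : 0 < n := by omega
  have h1 : 1 < n := by omega
  have := isPrime_span_X (k := k) (Var.c ⟨1, h1⟩ '' {i | i ∉ Λ} ∪ Var.b ⟨1, h1⟩ '' {i | i ∈ Λ} ∪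
    {Var.s, Var.c ⟨0, h0⟩ 1, Var.c ⟨0, h0⟩ 3, Var.c ⟨0, h0⟩ 4, Var.b ⟨0, h0⟩ 1, Var.b ⟨0, h0⟩ 2})
  convert this using 1
  simp only [Pneg4, Submodule.add_eq_sup, ← Ideal.span_union, Set.image_union, Set.image_image,
    Set.image_insert_eq, Set.image_singleton, s, c_of_lt h0, b_of_lt h0, c_of_lt h1, b_of_lt h1]
  congr 3
  · ext x; simp [eq_comm]
  · ext x; simp [eq_comm]

end Primality

end MayrMeyer
namespace MayrMeyer

/-! ### The listed ideals contain `J`. -/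

section GeneratorsOfJ

variable {k : Type*} [Field k] {n : ℕ} {A : Type*} [CommRing A]

/-- The equations expressing that a homomorphism `ψ` vanishes on `J(n,d)`. -/
structure VanishesOnJ (d : ℕ) (ψ : R k n →+* A) : Prop where
  h0 : ∀ i, ψ (c 0 i) * (ψ s - ψ f * ψ (b 0 i) ^ d) = 0
  h13 : ψ f * ψ (c 0 1) - ψ s * ψ (c 0 2) = 0
  h14 : ψ f * ψ (c 0 4) - ψ s * ψ (c 0 3) = 0
  h15 : ψ s * (ψ (c 0 3) - ψ (c 0 2)) = 0
  h16 : ψ f * (ψ (c 0 2) * ψ (b 0 1) - ψ (c 0 3) * ψ (b 0 4)) = 0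
  h1 : ∀ i, ψ f * ψ (c 0 2) * ψ (c 1 i) * (ψ (b 0 2) - ψ (b 1 i) * ψ (b 0 3)) = 0
  -- From here on the level is `r = m + 2`, which avoids truncated subtraction.
  h3 : ∀ m, m + 2 ≤ n → ψ s * ψ (cProd m) *
    (ψ (c m 4) * ψ (c (m + 1) 1) - ψ (c m 1) * ψ (c (m + 1) 2)) = 0
  h4 : ∀ m, m + 2 ≤ n → ψ s * ψ (cProd m) *
    (ψ (c m 4) * ψ (c (m + 1) 4) - ψ (c m 1) * ψ (c (m + 1) 3)) = 0
  h5 : ∀ m, m + 2 ≤ n → ψ s * (ψ (cProd m) * ψ (c m 1)) *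
    (ψ (c (m + 1) 3) - ψ (c (m + 1) 2)) = 0
  h6 : ∀ m, m + 2 ≤ n → ψ s * ψ (cProd m) * ψ (c m 4) *
    (ψ (c (m + 1) 2) * ψ (b (m + 1) 1) - ψ (c (m + 1) 3) * ψ (b (m + 1) 4)) = 0
  h_last : ∀ m i, m + 2 < n → ψ s * ψ (cProd m) * ψ (c m 4) * ψ (c (m + 1) 2) *
    ψ (c (m + 2) i) * (ψ (b (m + 1) 2) - ψ (b (m + 2) i) * ψ (b (m + 1) 3)) = 0
  h7 : ∀ m, m + 2 = n → ψ s * ψ (cProd m) * ψ (c m 4) * ψ (c (m + 1) 2) *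
    (ψ (b (m + 1) 2) - ψ (b (m + 1) 3)) = 0

lemma cProd_succ (m : ℕ) : (cProd (m + 1) : R k n) = cProd m * c m 1 :=
  Finset.prod_range_succ _ _

lemma J_le_ker (hn : 2 ≤ n) {d : ℕ} {ψ : R k n →+* A} :
    J k n d ≤ RingHom.ker ψ ↔ VanishesOnJ d ψ := by
  rw [J, Ideal.span_le]
  simp only [Set.union_subset_iff, Set.singleton_subset_iff, SetLike.mem_coe, RingHom.mem_ker]
  constructor
  · rintro ⟨⟨⟨⟨h0, h1⟩, hF⟩, hL⟩, h7⟩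
    simp only [level1, Set.union_subset_iff, Set.insert_subset_iff, Set.singleton_subset_iff,
      SetLike.mem_coe, RingHom.mem_ker, map_mul, map_sub] at h1
    obtain ⟨⟨h13, h14, h15, h16⟩, h1⟩ := h1
    have hF' : ∀ m, m + 2 ≤ n → levelFirst (m + 2) ⊆ (RingHom.ker ψ : Set (R k n)) :=
      fun m hm x hx ↦ hF ⟨m + 2, by omega, hm, hx⟩
    simp only [levelFirst, Nat.add_sub_cancel, show ∀ m, m + 2 - 1 = m + 1 from fun _ ↦ rfl,
      cProd_succ, Set.insert_subset_iff, Set.singleton_subset_iff,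
      SetLike.mem_coe, RingHom.mem_ker, map_mul, map_sub] at hF'
    refine ⟨fun i ↦ ?_, h13, h14, h15, h16, fun i ↦ ?_, fun m hm ↦ (hF' m hm).1,
      fun m hm ↦ (hF' m hm).2.1, fun m hm ↦ (hF' m hm).2.2.1, fun m hm ↦ (hF' m hm).2.2.2,
      fun m i hm ↦ ?_, ?_⟩
    · simpa using h0 ⟨i, rfl⟩
    · simpa using h1 ⟨i, rfl⟩
    · have : _ ∈ (RingHom.ker ψ : Set (R k n)) := hL ⟨m + 2, by omega, hm, i, rfl⟩
      simpa only [SetLike.mem_coe, RingHom.mem_ker, map_mul, map_sub, Nat.add_sub_cancel,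
        show m + 2 - 1 = m + 1 from rfl] using this
    · rintro m rfl
      simpa only [map_mul, map_sub, Nat.add_sub_cancel, show m + 2 - 1 = m + 1 from rfl] using h7
  · intro h
    refine ⟨⟨⟨⟨?_, Set.union_subset ?_ ?_⟩, ?_⟩, ?_⟩, ?_⟩
    · rintro _ ⟨i, rfl⟩
      simpa only [SetLike.mem_coe, RingHom.mem_ker, map_mul, map_sub, map_pow] using h.h0 i
    · simp only [Set.insert_subset_iff, Set.singleton_subset_iff,
        SetLike.mem_coe, RingHom.mem_ker, map_mul, map_sub]
      exact ⟨h.h13, h.h14, h.h15, h.h16⟩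
    · rintro _ ⟨i, rfl⟩
      simpa only [SetLike.mem_coe, RingHom.mem_ker, map_mul, map_sub, map_pow] using h.h1 i
    · rintro x ⟨r, hr2, hr, hx⟩
      obtain ⟨m, rfl⟩ := Nat.exists_eq_add_of_le' hr2
      revert x
      change levelFirst (m + 2) ⊆ (RingHom.ker ψ : Set (R k n))
      simp only [levelFirst, Nat.add_sub_cancel, show m + 2 - 1 = m + 1 from rfl,
        cProd_succ, Set.insert_subset_iff, Set.singleton_subset_iff,
        SetLike.mem_coe, RingHom.mem_ker, map_mul, map_sub]
      exact ⟨h.h3 m hr, h.h4 m hr, h.h5 m hr, h.h6 m hr⟩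
    · rintro _ ⟨r, hr2, hr, i, rfl⟩
      obtain ⟨m, rfl⟩ := Nat.exists_eq_add_of_le' hr2
      simpa only [SetLike.mem_coe, RingHom.mem_ker, map_mul, map_sub, Nat.add_sub_cancel,
        show m + 2 - 1 = m + 1 from rfl] using h.h_last m i hr
    · obtain ⟨m, rfl⟩ := Nat.exists_eq_add_of_le' hn
      simpa only [map_mul, map_sub, Nat.add_sub_cancel,
        show m + 2 - 1 = m + 1 from rfl] using h.h7 m rfl

/-- Over `s = 0`, only the generators of levels `0` and `1` matter. -/
lemma VanishesOnJ.of_s_eq_zero {d : ℕ} {ψ : R k n →+* A} (hs : ψ s = 0)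
    (h0 : ∀ i, ψ (c 0 i) * (ψ f * ψ (b 0 i) ^ d) = 0)
    (h13 : ψ f * ψ (c 0 1) = 0) (h14 : ψ f * ψ (c 0 4) = 0)
    (h16 : ψ f * (ψ (c 0 2) * ψ (b 0 1) - ψ (c 0 3) * ψ (b 0 4)) = 0)
    (h1 : ∀ i, ψ f * ψ (c 0 2) * ψ (c 1 i) * (ψ (b 0 2) - ψ (b 1 i) * ψ (b 0 3)) = 0) :
    VanishesOnJ d ψ where
  h0 i := by rw [hs, zero_sub, mul_neg, h0, neg_zero]
  h13 := by rw [hs, h13]; simp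
  h14 := by rw [hs, h14]; simp
  h15 := by simp [hs]
  h16 := h16
  h1 := h1
  h3 := by simp [hs]
  h4 := by simp [hs]
  h5 := by simp [hs]
  h6 := by simp [hs]
  h_last := by simp [hs]
  h7 := by simp [hs]

/-- Up to level 2 every term contains some `c_{0i}` explicitly; beyond that the product `cProd`
contains `c_{01}`. -/
lemma VanishesOnJ.of_c_zero {d : ℕ} {ψ : R k n →+* A} (hc : ∀ i, ψ (c 0 i) = 0) :
    VanishesOnJ d ψ := by
  have hP : ∀ m, ψ (cProd (m + 1)) = 0 := fun m ↦ by
    rw [cProd, map_prod]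
    exact Finset.prod_eq_zero (Finset.mem_range.2 m.succ_pos) (hc 1)
  constructor
  any_goals simp [hc]; done
  all_goals rintro (_ | m) <;> simp [hc, hP]

lemma VanishesOnPr.vanishesOnJ {d r : ℕ} (hr1 : 1 ≤ r) {α β : k}
    (hα : α ^ d = 1) (hβ : β ^ d = 1) {ψ : R k n →+* A} (h : VanishesOnPr d r α β ψ) (hr : r ≤ n) :
    VanishesOnJ d ψ := by
  obtain ⟨hp2, hp1⟩ := map_pow_b01 hα hβ h.b02 h.b01
  have hP : ∀ m, r < m → ψ (cProd m) = 0 := fun m hm ↦ by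
    rw [cProd, map_prod]
    exact Finset.prod_eq_zero (Finset.mem_range.2 hm) (h.c_zero 1)
  have hc4 : ∀ m < r, ψ (c m 4) = ψ (c m 1) := fun m hm ↦ by
    rcases Nat.eq_zero_or_pos m with rfl | h0
    · exact h.c04
    · exact h.c_eq m 4 h0 hm
  have hb : ∀ m, 1 ≤ m → m < r → ∀ i j, ψ (b m i) = ψ (b m j) := fun m h1 hm i j ↦ by
    rcases h1.lt_or_eq with h1 | rfl
    · rw [h.b_one m i h1 hm, h.b_one m j h1 hm]
    · rw [h.b_beta hm i, h.b_beta hm j]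
  -- Past `r` the product `cProd m` contains `c_{r1} = 0`; for `m = r` or `m + 1 = r` every term has
  -- a vanishing `c` of level `r`; for `m + 1 < r` the equalities among the `b`'s and `c`'s cancel.
  have hcase : ∀ m, r < m ∨ m = r ∨ m + 1 = r ∨ m + 1 < r := fun m ↦ by omega
  constructor
  · rw [forall_fin_four]
    refine ⟨?_, ?_, ?_, ?_⟩
    · rw [hp1, h.s_eq, sub_self, mul_zero]
    · rw [hp2, h.s_eq, sub_self, mul_zero]
    · rw [h.s_eq, sub_self, mul_zero]
    · rw [h.b04, hp1, h.s_eq, sub_self, mul_zero]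
  · rw [h.c01, h.s_eq]; ring
  · rw [h.c04, h.c03, h.c01, h.s_eq]; ring
  · rw [h.c03, sub_self, mul_zero]
  · rw [h.c03, h.b04, sub_self, mul_zero]
  · intro i
    rcases hr1.lt_or_eq with h1 | rfl
    · rw [h.b_beta h1, h.b02, sub_self, mul_zero]
    · rw [h.c_zero]; simp
  · intro m hm
    rcases hcase m with h1 | rfl | rfl | h1
    · simp [hP m h1]
    · simp [h.c_zero]
    · simp [h.c_zero]
    · rw [hc4 m (by omega), h.c_eq (m + 1) 2 (by omega) h1]; ring
  · intro m hm
    rcases hcase m with h1 | rfl | rfl | h1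
    · simp [hP m h1]
    · simp [h.c_zero]
    · simp only [h.c_zero]; ring
    · rw [hc4 m (by omega), h.c_eq (m + 1) 3 (by omega) h1, h.c_eq (m + 1) 4 (by omega) h1]; ring
  · intro m hm
    rcases hcase m with h1 | rfl | rfl | h1
    · simp [hP m h1]
    · simp [h.c_zero]
    · simp [h.c_zero]
    · rw [h.c_eq (m + 1) 3 (by omega) h1, h.c_eq (m + 1) 2 (by omega) h1]; ring
  · intro m hm
    rcases hcase m with h1 | rfl | rfl | h1
    · simp [hP m h1]
    · simp only [h.c_zero]; ring
    · simp only [h.c_zero]; ring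
    · rw [h.c_eq (m + 1) 3 (by omega) h1, h.c_eq (m + 1) 2 (by omega) h1,
        hb (m + 1) (by omega) h1 1 4]
      ring
  · intro m i hm
    rcases hcase m with h1 | rfl | rfl | h1
    · simp [hP m h1]
    · simp only [h.c_zero]; ring
    · simp only [h.c_zero]; ring
    -- These generators also involve level `m + 2`, which may be the vanishing level `r`.
    · rcases Nat.lt_or_ge (m + 2) r with h2 | h2
      · rw [h.b_one (m + 2) i (by omega) h2, hb (m + 1) (by omega) h1 2 3]; ring
      · obtain rfl : r = m + 2 := by omega
        rw [h.c_zero]; ring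
  · intro m hm
    rcases hcase m with h1 | rfl | rfl | h1
    · simp [hP m h1]
    · simp only [h.c_zero]; ring
    · simp only [h.c_zero]; ring
    · rw [hb (m + 1) (by omega) h1 2 3]; ring

lemma P0_le_ker {ψ : R k n →+* A} : P0 ≤ RingHom.ker ψ ↔ ∀ i, ψ (c 0 i) = 0 := by
  rw [forall_fin_four]
  simp only [P0, Ideal.span_le, Set.insert_subset_iff, Set.singleton_subset_iff,
    SetLike.mem_coe, RingHom.mem_ker]

lemma Pneg1_le_ker {ψ : R k n →+* A} : Pneg1 ≤ RingHom.ker ψ ↔ ψ s = 0 ∧ ψ f = 0 := by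
  simp only [Pneg1, Ideal.span_le, Set.insert_subset_iff, Set.singleton_subset_iff,
    SetLike.mem_coe, RingHom.mem_ker]

lemma Pneg2_le_ker {ψ : R k n →+* A} : Pneg2 ≤ RingHom.ker ψ ↔ ψ s = 0 ∧ ψ (c 0 1) = 0 ∧
    ψ (c 0 2) = 0 ∧ ψ (c 0 4) = 0 ∧ ψ (b 0 3) = 0 ∧ ψ (b 0 4) = 0 := by
  simp only [Pneg2, Ideal.span_le, Set.insert_subset_iff, Set.singleton_subset_iff,
    SetLike.mem_coe, RingHom.mem_ker]

lemma Pneg3_le_ker {ψ : R k n →+* A} : Pneg3 ≤ RingHom.ker ψ ↔ ψ s = 0 ∧ ψ (c 0 1) = 0 ∧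
    ψ (c 0 4) = 0 ∧ ψ (b 0 2) = 0 ∧ ψ (b 0 3) = 0 ∧
      ψ (c 0 2) * ψ (b 0 1) - ψ (c 0 3) * ψ (b 0 4) = 0 := by
  simp only [Pneg3, Ideal.span_le, Set.insert_subset_iff, Set.singleton_subset_iff,
    SetLike.mem_coe, RingHom.mem_ker, map_sub, map_mul]

lemma Pneg4_le_ker {ψ : R k n →+* A} {Λ : Finset (Fin 4)} : Pneg4 Λ ≤ RingHom.ker ψ ↔
    (∀ i ∉ Λ, ψ (c 1 i) = 0) ∧ (∀ i ∈ Λ, ψ (b 1 i) = 0) ∧ ψ s = 0 ∧ ψ (c 0 1) = 0 ∧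
      ψ (c 0 3) = 0 ∧ ψ (c 0 4) = 0 ∧ ψ (b 0 1) = 0 ∧ ψ (b 0 2) = 0 := by
  simp only [Pneg4, Submodule.add_eq_sup, sup_le_iff, Ideal.span_le, Set.insert_subset_iff,
    Set.singleton_subset_iff, SetLike.mem_coe, RingHom.mem_ker, and_assoc]
  refine and_congr ⟨fun h i hi ↦ h ⟨i, hi, rfl⟩, ?_⟩ (and_congr ⟨fun h i hi ↦ h ⟨i, hi, rfl⟩, ?_⟩
    Iff.rfl) <;>
  · rintro h _ ⟨i, hi, rfl⟩
    exact h i hi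

lemma J_le_P0 (hn : 2 ≤ n) (d : ℕ) : J k n d ≤ P0 := by
  have h := (P0_le_ker (ψ := Ideal.Quotient.mk (P0 : Ideal (R k n)))).1 (by rw [Ideal.mk_ker])
  rw [← Ideal.mk_ker (I := (P0 : Ideal (R k n))), J_le_ker hn]
  exact .of_c_zero h

lemma J_le_Pr (hn : 2 ≤ n) {d r : ℕ} (hr1 : 1 ≤ r) (hr : r ≤ n) {α β : k}
    (hα : α ^ d = 1) (hβ : β ^ d = 1) : J k n d ≤ Pr d r α β := by
  have h := (Pr_le_ker hr1 hr hα hβ (ψ := Ideal.Quotient.mk (Pr d r α β : Ideal (R k n)))).1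
    (by rw [Ideal.mk_ker])
  rw [← Ideal.mk_ker (I := (Pr d r α β : Ideal (R k n))), J_le_ker hn]
  exact h.vanishesOnJ hr1 hα hβ hr

lemma J_le_Pneg1 (hn : 2 ≤ n) (d : ℕ) : J k n d ≤ Pneg1 := by
  obtain ⟨hs, hf⟩ := (Pneg1_le_ker (ψ := Ideal.Quotient.mk (Pneg1 : Ideal (R k n)))).1
    (by rw [Ideal.mk_ker])
  rw [← Ideal.mk_ker (I := (Pneg1 : Ideal (R k n))), J_le_ker hn]
  apply VanishesOnJ.of_s_eq_zero hs <;> simp [hf]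

lemma J_le_Pneg2 (hn : 2 ≤ n) {d : ℕ} (hd : d ≠ 0) : J k n d ≤ Pneg2 := by
  obtain ⟨hs, h1, h2, h4, h3, h4'⟩ := (Pneg2_le_ker
    (ψ := Ideal.Quotient.mk (Pneg2 : Ideal (R k n)))).1 (by rw [Ideal.mk_ker])
  rw [← Ideal.mk_ker (I := (Pneg2 : Ideal (R k n))), J_le_ker hn]
  apply VanishesOnJ.of_s_eq_zero hs
  · rw [forall_fin_four]
    simp only [h1, h2, h3, h4, zero_pow hd, mul_zero, zero_mul, and_self]
  all_goals simp only [h1, h2, h4, h4', mul_zero, zero_mul, sub_self, implies_true]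

lemma J_le_Pneg3 (hn : 2 ≤ n) {d : ℕ} (hd : d ≠ 0) : J k n d ≤ Pneg3 := by
  obtain ⟨hs, h1, h4, h2, h3, hq⟩ := (Pneg3_le_ker
    (ψ := Ideal.Quotient.mk (Pneg3 : Ideal (R k n)))).1 (by rw [Ideal.mk_ker])
  rw [← Ideal.mk_ker (I := (Pneg3 : Ideal (R k n))), J_le_ker hn]
  apply VanishesOnJ.of_s_eq_zero hs
  · rw [forall_fin_four]
    simp only [h1, h2, h3, h4, zero_pow hd, mul_zero, zero_mul, and_self]
  all_goals simp only [h1, h2, h3, h4, hq, mul_zero, sub_self, implies_true]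

lemma J_le_Pneg4 (hn : 2 ≤ n) {d : ℕ} (hd : d ≠ 0) (Λ : Finset (Fin 4)) :
    J k n d ≤ Pneg4 Λ := by
  obtain ⟨hc, hb, hs, h1, h3, h4, h1', h2⟩ := (Pneg4_le_ker
    (ψ := Ideal.Quotient.mk (Pneg4 Λ : Ideal (R k n)))).1 (by rw [Ideal.mk_ker])
  rw [← Ideal.mk_ker (I := (Pneg4 Λ : Ideal (R k n))), J_le_ker hn]
  apply VanishesOnJ.of_s_eq_zero hs
  · rw [forall_fin_four]
    simp only [h1, h2, h3, h4, zero_pow hd, mul_zero, zero_mul, and_self]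
  any_goals simp only [h1, h3, h4, h1', mul_zero, zero_mul, sub_self]
  · intro i
    by_cases hi : i ∈ Λ
    · rw [hb i hi, h2]; ring
    · rw [hc i hi]; ring

end GeneratorsOfJ

/-! ### Every prime over `J` contains a listed prime. -/

section Covering

variable {k : Type*} [Field k] {n : ℕ} {A : Type*} [CommRing A] [IsDomain A]

/-- For `f ≠ 0` the relations become `c_{01} = c_{04} = 0`, `c_{0i} b_{0i} = 0`, and `c_{02} b_{01}
= c_{03} b_{04}`; the cases record which factors vanish. -/
lemma VanishesOnJ.exists_primesWithS_or_P0 {d : ℕ} {ψ : R k n →+* A} (h : VanishesOnJ d ψ)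
    (hs : ψ s = 0) : P0 ≤ RingHom.ker ψ ∨ ∃ I ∈ primesWithS k n, I ≤ RingHom.ker ψ := by
  by_cases hf : ψ f = 0
  · exact .inr ⟨Pneg1, by simp [primesWithS], Pneg1_le_ker.2 ⟨hs, hf⟩⟩
  have h01 : ψ (c 0 1) = 0 := by simpa [hs, hf] using h.h13
  have h04 : ψ (c 0 4) = 0 := by
    have := h.h14
    rw [hs, zero_mul, sub_zero] at this
    exact (mul_eq_zero.1 this).resolve_left hf
  have h16 := (mul_eq_zero.1 h.h16).resolve_left hf
  have hcb : ∀ i, ψ (c 0 i) = 0 ∨ ψ (b 0 i) = 0 := fun i ↦ by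
    have := h.h0 i
    rw [hs, zero_sub, mul_neg, neg_eq_zero] at this
    exact (mul_eq_zero.1 this).imp_right
      fun h ↦ eq_zero_of_pow_eq_zero ((mul_eq_zero.1 h).resolve_left hf)
  by_cases h02 : ψ (c 0 2) = 0
  · by_cases h03 : ψ (c 0 3) = 0
    · exact .inl (P0_le_ker.2 (forall_fin_four.2 ⟨h01, h02, h03, h04⟩))
    · rw [h02, zero_mul, zero_sub, neg_eq_zero] at h16
      exact .inr ⟨Pneg2, by simp [primesWithS], Pneg2_le_ker.2 ⟨hs, h01, h02, h04,
        (hcb 3).resolve_left h03, (mul_eq_zero.1 h16).resolve_left h03⟩⟩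
  have hb2 := (hcb 2).resolve_left h02
  by_cases hb3 : ψ (b 0 3) = 0
  · exact .inr ⟨Pneg3, by simp [primesWithS], Pneg3_le_ker.2 ⟨hs, h01, h04, hb2, hb3, h16⟩⟩
  have h03 := (hcb 3).resolve_right hb3
  rw [h03, zero_mul, sub_zero] at h16
  classical
  -- Now `f`, `c_{02}` and `b_{03}` are nonzero and `b_{02} = 0`, so `h_{1,6+i}` reduces to `c_{1i}
  -- b_{1i} = 0`; `Λ` records where `c_{1i}` survives.
  refine .inr ⟨Pneg4 {i | ψ (c 1 i) ≠ 0}, by simp [primesWithS], Pneg4_le_ker.2 ⟨fun i hi ↦ ?_,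
    fun i hi ↦ ?_, hs, h01, h03, h04, (mul_eq_zero.1 h16).resolve_left h02, hb2⟩⟩
  · simpa using hi
  · have := h.h1 i
    simpa [hf, h02, hb2, hb3, (Finset.mem_filter.1 hi).2] using this

/-- The consequences of the generators of `J` on a domain where `s` and some `c_{0i}` do not
vanish. -/
lemma VanishesOnJ.level_zero {d : ℕ} {ψ : R k n →+* A} (h : VanishesOnJ d ψ) (hs : ψ s ≠ 0)
    (hc : ¬ ∀ i, ψ (c 0 i) = 0) :
    ψ f ≠ 0 ∧ ψ (c 0 2) ≠ 0 ∧ ψ (c 0 1) ≠ 0 ∧ ψ (c 0 3) = ψ (c 0 2) ∧ ψ (c 0 4) = ψ (c 0 1) ∧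
      ψ (b 0 4) = ψ (b 0 1) ∧ (∀ i, ψ s = ψ f * ψ (b 0 i) ^ d) := by
  have hf : ψ f ≠ 0 := fun hf ↦ hc fun i ↦ by simpa [hf, hs] using h.h0 i
  have h32 : ψ (c 0 3) = ψ (c 0 2) := sub_eq_zero.1 ((mul_eq_zero.1 h.h15).resolve_left hs)
  have h41 : ψ (c 0 4) = ψ (c 0 1) := by
    have h13 := h.h13
    have h14 := h.h14
    rw [h32] at h14
    exact mul_left_cancel₀ hf ((sub_eq_zero.1 h14).trans (sub_eq_zero.1 h13).symm)
  have h2 : ψ (c 0 2) ≠ 0 := fun h2 ↦ hc <| by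
    have h1 : ψ (c 0 1) = 0 := by simpa [h2, hf] using h.h13
    exact forall_fin_four.2 ⟨h1, h2, h32.trans h2, h41.trans h1⟩
  have h1 : ψ (c 0 1) ≠ 0 := fun h1 ↦ by simpa [h1, hs, h2] using h.h13
  refine ⟨hf, h2, h1, h32, h41, ?_, ?_⟩
  · have := h.h16
    rw [h32, ← mul_sub] at this
    exact (sub_eq_zero.1 (by simpa [hf, h2] using this)).symm
  · have hne : ∀ i, ψ (c 0 i) ≠ 0 := forall_fin_four.2 ⟨h1, h2, h32 ▸ h2, h41 ▸ h1⟩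
    exact fun i ↦ sub_eq_zero.1 ((mul_eq_zero.1 (h.h0 i)).resolve_left (hne i))

/-- On a domain where `s` and each level of the variables `c_{ji}` with `j < r` do not vanish
identically, the variables `c_{ji}` of one level agree in pairs and are nonzero. -/
lemma VanishesOnJ.level_c {d r : ℕ} {ψ : R k n →+* A} (h : VanishesOnJ d ψ) (hs : ψ s ≠ 0)
    (hrn : r ≤ n) (hc : ∀ j < r, ¬ ∀ i, ψ (c j i) = 0) (j : ℕ) (hj : j < r) :
    ψ (c j 1) ≠ 0 ∧ ψ (c j 2) ≠ 0 ∧ ψ (c j 3) = ψ (c j 2) ∧ ψ (c j 4) = ψ (c j 1) ∧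
      (1 ≤ j → ψ (c j 2) = ψ (c j 1)) := by
  -- Strong induction, because cancelling `cProd m` needs `c_{i1} ≠ 0` on all lower levels.
  induction j using Nat.strong_induction_on with
  | _ j ih =>
    rcases j with _ | m
    · obtain ⟨-, h2, h1, h32, h41, -, -⟩ := h.level_zero hs (hc 0 hj)
      exact ⟨h1, h2, h32, h41, fun h ↦ by omega⟩
    · have hP : ψ (cProd m) ≠ 0 := by
        rw [cProd, map_prod, Finset.prod_ne_zero_iff]
        intro i hi
        have := Finset.mem_range.1 hi
        exact (ih i (by omega) (by omega)).1
      obtain ⟨hm1, -, -, hm4, -⟩ := ih m (by omega) (by omega)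
      have e3 := h.h3 m (by omega)
      have e4 := h.h4 m (by omega)
      have e5 := h.h5 m (by omega)
      -- Once `c_{m4} = c_{m1}`, both relations have the nonzero factor `c_{m1}`.
      rw [hm4, ← mul_sub] at e3 e4
      have e3 : ψ (c (m + 1) 1) = ψ (c (m + 1) 2) :=
        sub_eq_zero.1 (by simpa [hs, hP, hm1] using e3)
      have e4 : ψ (c (m + 1) 4) = ψ (c (m + 1) 3) := by
        have := (mul_eq_zero.1 e4).resolve_left (mul_ne_zero hs hP)
        exact sub_eq_zero.1 ((mul_eq_zero.1 this).resolve_left hm1)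
      have e5 : ψ (c (m + 1) 3) = ψ (c (m + 1) 2) :=
        sub_eq_zero.1 (by simpa [hs, hP, hm1] using e5)
      have hne : ψ (c (m + 1) 1) ≠ 0 := fun h0 ↦ hc (m + 1) hj <| by
        rw [forall_fin_four, e4, e5, ← e3]
        simp [h0]
      exact ⟨hne, e3 ▸ hne, e5, by rw [e4, e5, e3], fun _ ↦ e3.symm⟩

lemma VanishesOnJ.exists_Pr [IsAlgClosed k] {d d' : ℕ} (hn : 2 ≤ n) (hd : d ≠ 0) (hd' : IsPrimeToCharPart k d d')
    {ψ : R k n →+* A} (h : VanishesOnJ d ψ) (hs : ψ s ≠ 0) (hc : ¬ ∀ i, ψ (c 0 i) = 0) :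
    ∃ (r : ℕ) (α β : k), 1 ≤ r ∧ r ≤ n ∧ α ^ d' = 1 ∧ β ^ d' = 1 ∧ VanishesOnPr d r α β ψ := by
  classical
  obtain ⟨hf, h2, h1, h32, h41, hb41, hsb⟩ := h.level_zero hs hc
  have hex : ∃ r, 1 ≤ r ∧ ∀ i, ψ (c r i) = 0 := ⟨n, by omega, fun i ↦ by rw [c_self, map_zero]⟩
  obtain ⟨r, ⟨hr1, hr0⟩, hmin⟩ : ∃ r, (1 ≤ r ∧ ∀ i, ψ (c r i) = 0) ∧
      ∀ j < r, ¬ (1 ≤ j ∧ ∀ i, ψ (c j i) = 0) :=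
    ⟨Nat.find hex, Nat.find_spec hex, fun j hj ↦ Nat.find_min hex hj⟩
  have hrn : r ≤ n := by
    by_contra hlt
    exact hmin n (by omega) ⟨by omega, fun i ↦ by rw [c_self, map_zero]⟩
  have hcj : ∀ j < r, ¬ ∀ i, ψ (c j i) = 0 := fun j hj h0 ↦ by
    rcases Nat.eq_zero_or_pos j with rfl | hj0
    · exact hc h0
    · exact hmin j hj ⟨hj0, h0⟩
  have hlev := h.level_c hs hrn hcj
  have hci : ∀ j i, 1 ≤ j → j < r → ψ (c j i) = ψ (c j 1) := fun j i h1 hj ↦ by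
    obtain ⟨-, -, h3, h4, h2⟩ := hlev j hj
    revert i
    exact forall_fin_four.2 ⟨rfl, h2 h1, h3.trans (h2 h1), h4⟩
  have hpow : ∀ i j, ψ (b 0 i) ^ d = ψ (b 0 j) ^ d := fun i j ↦
    mul_left_cancel₀ hf ((hsb i).symm.trans (hsb j))
  -- From `s = f b_{0i} ^ d` for all `i`, the `d`-th powers of the `b_{0i}` coincide.
  obtain ⟨α, hα, hα1⟩ := hd'.exists_eq_mul_of_pow_eq hd (ψ.comp MvPolynomial.C) (hpow 1 2)
  obtain ⟨β, hβ, hβ2⟩ := hd'.exists_eq_mul_of_pow_eq hd (ψ.comp MvPolynomial.C) (hpow 2 3)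
  have hb3 : ψ (b 0 3) ≠ 0 := fun h0 ↦ hs (by rw [hsb 3, h0, zero_pow hd, mul_zero])
  have hb1 : 2 ≤ r → ∀ i, ψ (b 1 i) = ψ (MvPolynomial.C β) := fun hr2 i ↦ by
    have := h.h1 i
    have hc1 : ψ (c 1 i) ≠ 0 := by rw [hci 1 i le_rfl hr2]; exact (hlev 1 hr2).1
    have := (mul_eq_zero.1 this).resolve_left (mul_ne_zero (mul_ne_zero hf h2) hc1)
    rw [hβ2, ← sub_mul] at this
    exact (sub_eq_zero.1 ((mul_eq_zero.1 this).resolve_right hb3)).symm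
  have hβ0 : ψ (MvPolynomial.C β) ≠ 0 := fun h0 ↦ hs <| by
    have hβ2' : ψ (b 0 2) = ψ (MvPolynomial.C β) * ψ (b 0 3) := hβ2
    rw [hsb 2, hβ2', h0, zero_mul, zero_pow hd, mul_zero]
  -- The values propagate upwards: at level 2 the relation reads `β (1 - b_{2i}) = 0`, and from then
  -- on the previous level equals `1`.
  have hb : ∀ m, m + 2 < r → ∀ i, ψ (b (m + 2) i) = 1 := fun m ↦ by
    induction m with
    | zero =>
      intro hm i
      have := h.h_last 0 i (by omega)
      have hne : ψ (c 2 i) ≠ 0 := by rw [hci 2 i (by omega) hm]; exact (hlev 2 hm).1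
      rw [zero_add, zero_add, hb1 (by omega), hb1 (by omega), ← one_sub_mul, h41] at this
      simp only [mul_eq_zero, hs, h1, (hlev 1 (by omega)).2.1, hne, hβ0, or_false, false_or, cProd,
        Finset.range_zero, Finset.prod_empty, map_one, one_ne_zero] at this
      exact (sub_eq_zero.1 this).symm
    | succ m ih =>
      intro hm i
      have := h.h_last (m + 1) i (by omega)
      have hne : ψ (c (m + 1 + 2) i) ≠ 0 := by
        rw [hci _ i (by omega) hm]; exact (hlev _ hm).1
      have hP : ψ (cProd (m + 1)) ≠ 0 := by
        rw [cProd, map_prod, Finset.prod_ne_zero_iff]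
        intro i hi
        exact (hlev i (by have := Finset.mem_range.1 hi; omega)).1
      have hm1 := hlev (m + 1) (by omega)
      have hm2 := hlev (m + 1 + 1) (by omega)
      rw [ih (by omega), ih (by omega), hm1.2.2.2.1, mul_one] at this
      simp only [mul_eq_zero, hs, hP, hm1.1, hm2.2.1, hne, false_or] at this
      exact (sub_eq_zero.1 this).symm
  refine ⟨r, α, β, hr1, hrn, hα, hβ, hsb 3, hβ2, hα1, hb41, ?_, h32, h41, hr0, hci, ?_, hb1⟩
  · have h13 := sub_eq_zero.1 h.h13
    rw [hsb 3] at h13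
    exact mul_left_cancel₀ hf (by rw [h13]; ring)
  · intro j i hj hjr
    obtain ⟨m, rfl⟩ := Nat.exists_eq_add_of_le' hj
    exact hb m hjr i

lemma IsPrimeToCharPart.pow_eq_one {d d' : ℕ} (hd' : IsPrimeToCharPart k d d') {α : k}
    (hα : α ^ d' = 1) : α ^ d = 1 := by
  obtain ⟨m, rfl⟩ := hd'.1.1
  rw [pow_mul, hα, one_pow]

lemma exists_listedPrimes_le [IsAlgClosed k] {d d' : ℕ} (hn : 2 ≤ n) (hd : d ≠ 0)
    (hd' : IsPrimeToCharPart k d d') {P : Ideal (R k n)} (hP : P.IsPrime) (hJ : J k n d ≤ P) :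
    ∃ I ∈ listedPrimes k n d d', I ≤ P := by
  have h := (J_le_ker hn (ψ := Ideal.Quotient.mk P)).1 (by rwa [Ideal.mk_ker])
  have key : ∃ I ∈ listedPrimes k n d d', I ≤ RingHom.ker (Ideal.Quotient.mk P) := by
    by_cases hc : ∀ i, Ideal.Quotient.mk P (c 0 i) = 0
    · exact ⟨P0, .inl (.inl rfl), P0_le_ker.2 hc⟩
    by_cases hs : Ideal.Quotient.mk P s = 0
    · rcases h.exists_primesWithS_or_P0 hs with h0 | ⟨I, hI, hIP⟩
      · exact ⟨P0, .inl (.inl rfl), h0⟩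
      · exact ⟨I, .inr hI, hIP⟩
    · obtain ⟨r, α, β, hr1, hr, hα, hβ, hv⟩ := h.exists_Pr hn hd hd' hs hc
      exact ⟨Pr d r α β, .inl (.inr ⟨r, α, β, hr1, hr, hα, hβ, rfl⟩),
        (Pr_le_ker hr1 hr (hd'.pow_eq_one hα) (hd'.pow_eq_one hβ)).2 hv⟩
  rwa [Ideal.mk_ker] at key

end Covering

end MayrMeyer
namespace MayrMeyer

/-! ### Separating points and counting. -/

section Family

variable {k : Type*} [Field k]

variable (k) in
/-- The index type of the listed primes; the four values of `Fin 4` stand for `P_0`, `P_{-1}`,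
`P_{-2}`, `P_{-3}`, and `Finset (Fin 4)` for the primes `P_{-4Λ}`. -/
abbrev PrimeIndex (n m : ℕ) : Type _ :=
  (Fin n × {α : k // α ^ m = 1} × {β : k // β ^ m = 1}) ⊕ (Fin 4 ⊕ Finset (Fin 4))

/-- The listed primes as a family. -/
noncomputable def primeFamily (d : ℕ) {n m : ℕ} : PrimeIndex k n m → Ideal (R k n)
  | .inl (r, α, β) => Pr d (r + 1) α.1 β.1
  | .inr (.inl 0) => P0
  | .inr (.inl 1) => Pneg1
  | .inr (.inl 2) => Pneg2
  | .inr (.inl 3) => Pneg3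
  | .inr (.inr Λ) => Pneg4 Λ

variable {n d d' : ℕ}

lemma range_primeFamily (n d d' : ℕ) :
    Set.range (primeFamily (k := k) d (n := n) (m := d')) = listedPrimes k n d d' := by
  ext I
  constructor
  · rintro ⟨⟨r, α, β⟩ | i | Λ, rfl⟩
    · exact .inl (.inr ⟨r + 1, α, β, by omega, by omega, α.2, β.2, rfl⟩)
    · fin_cases i
      · exact .inl (.inl rfl)
      · exact .inr (.inl (.inl rfl))
      · exact .inr (.inl (.inr (.inl rfl)))
      · exact .inr (.inl (.inr (.inr rfl)))
    · exact .inr (.inr ⟨Λ, rfl⟩)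
  · rintro ((rfl | ⟨r, α, β, hr1, hr, hα, hβ, rfl⟩) | ((rfl | rfl | rfl) | ⟨Λ, rfl⟩))
    · exact ⟨.inr (.inl 0), rfl⟩
    · refine ⟨.inl (⟨r - 1, by omega⟩, ⟨α, hα⟩, ⟨β, hβ⟩), ?_⟩
      simp only [primeFamily, Nat.sub_add_cancel hr1]
    · exact ⟨.inr (.inl 1), rfl⟩
    · exact ⟨.inr (.inl 2), rfl⟩
    · exact ⟨.inr (.inl 3), rfl⟩
    · exact ⟨.inr (.inr Λ), rfl⟩

lemma isPrime_primeFamily (hn : 2 ≤ n) (hd' : IsPrimeToCharPart k d d') (i : PrimeIndex k n d') :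
    (primeFamily d i).IsPrime := by
  rcases i with ⟨r, α, β⟩ | i | Λ
  · exact isPrime_Pr hn (by omega) (by omega) (hd'.pow_eq_one α.2) (hd'.pow_eq_one β.2)
  · fin_cases i
    exacts [isPrime_P0 hn, isPrime_Pneg1, isPrime_Pneg2 hn, isPrime_Pneg3 hn]
  · exact isPrime_Pneg4 hn Λ

lemma J_le_primeFamily (hn : 2 ≤ n) (hd : d ≠ 0) (hd' : IsPrimeToCharPart k d d')
    (i : PrimeIndex k n d') : J k n d ≤ primeFamily d i := by
  rcases i with ⟨r, α, β⟩ | i | Λ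
  · exact J_le_Pr hn (by omega) (by omega) (hd'.pow_eq_one α.2) (hd'.pow_eq_one β.2)
  · fin_cases i
    exacts [J_le_P0 hn d, J_le_Pneg1 hn d, J_le_Pneg2 hn hd, J_le_Pneg3 hn hd]
  · exact J_le_Pneg4 hn hd Λ

/-- Each listed prime has a zero that is a zero of no other listed prime. -/
lemma exists_separating_point (hn : 2 ≤ n) (hd : d ≠ 0) (hd' : IsPrimeToCharPart k d d')
    (j : PrimeIndex k n d') : ∃ ψ : R k n →+* k, primeFamily d j ≤ RingHom.ker ψ ∧
      ∀ i : PrimeIndex k n d', primeFamily d i ≤ RingHom.ker ψ → i = j := by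
  have h0 : 0 < n := by omega
  have h1 : 1 < n := by omega
  have hPr : ∀ {ψ : R k n →+* k} {r : Fin n} {α β : {α : k // α ^ d' = 1}},
      Pr d (r + 1) α.1 β.1 ≤ RingHom.ker ψ ↔ VanishesOnPr d (r + 1) α.1 β.1 ψ := fun {ψ r α β} ↦
    Pr_le_ker (by omega) (by omega) (hd'.pow_eq_one α.2) (hd'.pow_eq_one β.2)
  have hne : ∀ β : {α : k // α ^ d' = 1}, β.1 ≠ 0 := fun β h ↦ by
    have := hd'.pow_eq_one β.2
    rw [h, zero_pow hd] at this
    exact zero_ne_one this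
  rcases j with ⟨r, α, β⟩ | j | Λ
  -- Index `r` stands for level `r + 1`. The `c`'s are `1` up to level `r`, which excludes smaller
  -- indices; at level `r + 1` the `b`'s are `0`, whereas larger indices require a root of unity or
  -- `1` there. The values at level 0 recover `α` and `β`.
  · let bv : ℕ → Fin 4 → k := fun j i ↦
      if j = 0 then (if i = 3 then 1 else if i = 2 then β else α * β)
      else if j < r + 1 then (if j = 1 then β else 1) else 0
    let cv : ℕ → Fin 4 → k := fun j _ ↦ if j < r + 1 then 1 else 0
    refine ⟨(evalAt (k := k) 1 1 bv cv).toRingHom, hPr.2 ?_, ?_⟩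
    · constructor <;> simp only [AlgHom.toRingHom_eq_coe, RingHom.coe_coe, evalAt_s, evalAt_f,
        evalAt_C, evalAt_b _ _ _ _ h0, evalAt_c _ _ _ _ h0, Algebra.algebraMap_self_apply]
      any_goals simp [bv, cv]; done
      · intro i
        rcases (show (r : ℕ) + 1 < n ∨ (r : ℕ) + 1 = n by omega) with h | h
        · rw [evalAt_c _ _ _ _ h]; simp [cv]
        · rw [h, c_self, map_zero]
      · intro j i h1 h2
        rw [evalAt_c _ _ _ _ (by omega), evalAt_c _ _ _ _ (by omega)]
      · intro j i h1 h2
        rw [evalAt_b _ _ _ _ (by omega)]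
        simp only [bv, h2, show j ≠ 0 by omega, show j ≠ 1 by omega, if_true, if_false]
      · intro h2 i
        rw [evalAt_b _ _ _ _ (by omega)]
        simp only [bv, one_ne_zero, if_true, if_false]
        rw [if_pos (by omega)]
    · rintro (⟨r', α', β'⟩ | i | Λ) hi
      · have h := hPr.1 hi
        have hβ : β = β' := Subtype.ext <| by
          have := h.b02
          simpa [evalAt_b _ _ _ _ h0, bv] using this
        have hα : α = α' := Subtype.ext <| by
          have := h.b01
          simpa [evalAt_b _ _ _ _ h0, bv, hne] using this
        have hr : r' = r := by
          rcases lt_trichotomy r' r with hlt | heq | hgt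
          · have hlt : (r' : ℕ) < r := hlt
            have := h.c_zero 1
            simp [evalAt_c _ _ _ _ (show (r' : ℕ) + 1 < n by omega), cv, hlt] at this
          · exact heq
          · have hgt : (r : ℕ) < r' := hgt
            have hrn : (r : ℕ) + 1 < n := by omega
            have hb : (evalAt (k := k) (n := n) 1 1 bv cv).toRingHom (b (r + 1) 1) = 0 := by
              simp [evalAt_b _ _ _ _ hrn, bv]
            rcases Nat.eq_zero_or_pos (r : ℕ) with hr0 | hr0
            · have := h.b_beta (by omega) 1
              rw [hr0, zero_add] at hb
              rw [hb] at this
              simp [eq_comm, hne] at this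
            · have := h.b_one (r + 1) 1 (by omega) (by omega)
              rw [hb] at this
              exact absurd this zero_ne_one
        rw [hα, hβ, hr]
      · fin_cases i
        · simpa [evalAt_c _ _ _ _ h0, cv] using P0_le_ker.1 hi 1
        · simpa using (Pneg1_le_ker.1 hi).1
        · simpa using (Pneg2_le_ker.1 hi).1
        · simpa using (Pneg3_le_ker.1 hi).1
      · simpa using (Pneg4_le_ker.1 hi).2.2.1
  · fin_cases j
    -- Here, and for `P_{-1}`, `P_{-2}` and `P_{-4Λ}`, unequal values of `b_{01}` and `b_{04}`
    -- exclude every `P_{rαβ}`.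
    · refine ⟨(evalAt (k := k) 1 0 (fun _ i ↦ if i = 1 then 1 else 0) 0).toRingHom,
        P0_le_ker.2 fun i ↦ by simp [evalAt_c _ _ _ _ h0], ?_⟩
      rintro (⟨r', α', β'⟩ | i | Λ) hi
      · simpa [evalAt_b _ _ _ _ h0] using (hPr.1 hi).b04
      · fin_cases i
        · rfl
        · simpa using (Pneg1_le_ker.1 hi).1
        · simpa using (Pneg2_le_ker.1 hi).1
        · simpa using (Pneg3_le_ker.1 hi).1
      · simpa using (Pneg4_le_ker.1 hi).2.2.1
    · refine ⟨(evalAt (k := k) 0 0 (fun _ i ↦ if i = 1 then 1 else 0) 1).toRingHom,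
        Pneg1_le_ker.2 (by simp), ?_⟩
      rintro (⟨r', α', β'⟩ | i | Λ) hi
      · simpa [evalAt_b _ _ _ _ h0] using (hPr.1 hi).b04
      · fin_cases i
        · simpa [evalAt_c _ _ _ _ h0] using P0_le_ker.1 hi 1
        · rfl
        · simpa [evalAt_c _ _ _ _ h0] using (Pneg2_le_ker.1 hi).2.1
        · simpa [evalAt_c _ _ _ _ h0] using (Pneg3_le_ker.1 hi).2.1
      · simpa [evalAt_c _ _ _ _ h0] using (Pneg4_le_ker.1 hi).2.2.2.1
    · refine ⟨(evalAt (k := k) 0 1 (fun _ i ↦ if i = 1 ∨ i = 2 then 1 else 0)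
        (fun _ i ↦ if i = 3 then 1 else 0)).toRingHom,
        Pneg2_le_ker.2 (by simp [evalAt_b _ _ _ _ h0, evalAt_c _ _ _ _ h0]), ?_⟩
      rintro (⟨r', α', β'⟩ | i | Λ) hi
      · simpa [evalAt_b _ _ _ _ h0] using (hPr.1 hi).b04
      · fin_cases i
        · simpa [evalAt_c _ _ _ _ h0] using P0_le_ker.1 hi 3
        · simpa using (Pneg1_le_ker.1 hi).2
        · rfl
        · simpa [evalAt_b _ _ _ _ h0] using (Pneg3_le_ker.1 hi).2.2.2.1
      · simpa [evalAt_c _ _ _ _ h0] using (Pneg4_le_ker.1 hi).2.2.2.2.1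
    -- All four nonzero values satisfy the quadric; `b_{01} = 1` with `b_{02} = 0` excludes
    -- `P_{rαβ}`.
    · refine ⟨(evalAt (k := k) 0 1 (fun _ i ↦ if i = 1 ∨ i = 4 then 1 else 0)
        (fun _ i ↦ if i = 2 ∨ i = 3 then 1 else 0)).toRingHom,
        Pneg3_le_ker.2 (by simp [evalAt_b _ _ _ _ h0, evalAt_c _ _ _ _ h0]), ?_⟩
      rintro (⟨r', α', β'⟩ | i | Λ) hi
      · simpa [evalAt_b _ _ _ _ h0] using (hPr.1 hi).b01
      · fin_cases i
        · simpa [evalAt_c _ _ _ _ h0] using P0_le_ker.1 hi 3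
        · simpa using (Pneg1_le_ker.1 hi).2
        · simpa [evalAt_c _ _ _ _ h0] using (Pneg2_le_ker.1 hi).2.2.1
        · rfl
      · simpa [evalAt_c _ _ _ _ h0] using (Pneg4_le_ker.1 hi).2.2.2.2.1
  -- At level 1, `c_{1i}` is the indicator of `Λ` and `b_{1i}` that of its complement; the two force
  -- inclusions in opposite directions, so `Λ' = Λ`.
  · refine ⟨(evalAt (k := k) 0 1
      (fun j i ↦ if j = 0 then (if i = 3 ∨ i = 4 then 1 else 0) else if i ∈ Λ then 0 else 1)
      (fun j i ↦ if j = 0 then (if i = 2 then 1 else 0) else if i ∈ Λ then 1 else 0)).toRingHom,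
      Pneg4_le_ker.2 ⟨fun i hi ↦ by simp [evalAt_c _ _ _ _ h1, hi],
        fun i hi ↦ by simp [evalAt_b _ _ _ _ h1, hi],
        by simp [evalAt_b _ _ _ _ h0, evalAt_c _ _ _ _ h0]⟩, ?_⟩
    rintro (⟨r', α', β'⟩ | i | Λ') hi
    · simpa [evalAt_b _ _ _ _ h0] using (hPr.1 hi).b04
    · fin_cases i
      · simpa [evalAt_c _ _ _ _ h0] using P0_le_ker.1 hi 2
      · simpa using (Pneg1_le_ker.1 hi).2
      · simpa [evalAt_c _ _ _ _ h0] using (Pneg2_le_ker.1 hi).2.2.1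
      · simpa [evalAt_b _ _ _ _ h0] using (Pneg3_le_ker.1 hi).2.2.2.2.1
    · obtain ⟨hc, hb, -⟩ := Pneg4_le_ker.1 hi
      congr 2
      ext i
      constructor
      · intro hi
        by_contra hi'
        simpa [evalAt_b _ _ _ _ h1, hi'] using hb i hi
      · intro hi
        by_contra hi'
        simpa [evalAt_c _ _ _ _ h1, hi] using hc i hi'

lemma primeFamily_le_iff (hn : 2 ≤ n) (hd : d ≠ 0) (hd' : IsPrimeToCharPart k d d')
    {i j : PrimeIndex k n d'} : primeFamily d i ≤ primeFamily d j ↔ i = j := by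
  refine ⟨fun h ↦ ?_, fun h ↦ h ▸ le_rfl⟩
  obtain ⟨ψ, hj, hψ⟩ := exists_separating_point hn hd hd' j
  exact hψ i (h.trans hj)

lemma natCard_pow_eq_one [IsAlgClosed k] {m : ℕ} (hm : (m : k) ≠ 0) :
    Nat.card {α : k // α ^ m = 1} = m := by
  obtain ⟨ζ, hζ⟩ := exists_isPrimitiveRoot hm
  have hpos : 0 < m := Nat.pos_of_ne_zero fun h0 ↦ hm (by simp [h0])
  rw [Nat.subtype_card _ fun _ ↦ Polynomial.mem_nthRootsFinset hpos 1, hζ.card_nthRootsFinset]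

/-- The constant is `4 + 2 ^ 4`: four single primes and the subsets of a four-element set. -/
lemma natCard_primeIndex [IsAlgClosed k] (n : ℕ) {m : ℕ} (hm : (m : k) ≠ 0) :
    Nat.card (PrimeIndex k n m) = n * m ^ 2 + 20 := by
  have hcard := natCard_pow_eq_one hm
  have : Finite {α : k // α ^ m = 1} := Nat.finite_of_card_ne_zero <| by
    rw [hcard]; rintro rfl; simp at hm
  rw [Nat.card_sum, Nat.card_prod, Nat.card_prod, hcard]
  simp [sq]

end Family

end MayrMeyer

/-! ### Assembly of covering, incomparability and count. -/

theorem proposition1p5 {k : Type*} [Field k] [IsAlgClosed k] (n d d' : ℕ)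
    (hn : 2 ≤ n) (hd : 2 ≤ d) (hd' : MayrMeyer.IsPrimeToCharPart k d d') :
    (MayrMeyer.J k n d).minimalPrimes = MayrMeyer.listedPrimes k n d d' ∧
      (MayrMeyer.J k n d).minimalPrimes.ncard = n * d' ^ 2 + 20 ∧
      IsAntichain (· ≤ ·) (MayrMeyer.listedPrimes k n d d') := by
  have hd0 : d ≠ 0 := by omega
  have hle := fun i j ↦ MayrMeyer.primeFamily_le_iff hn hd0 hd' (i := i) (j := j)
  have hrange := MayrMeyer.range_primeFamily (k := k) n d d'
  have hanti : IsAntichain (· ≤ ·) (MayrMeyer.listedPrimes k n d d') := by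
    rw [← hrange]
    rintro _ ⟨i, rfl⟩ _ ⟨j, rfl⟩ hne h
    exact hne (congrArg _ ((hle i j).1 h))
  have hmin : (MayrMeyer.J k n d).minimalPrimes = MayrMeyer.listedPrimes k n d d' := by
    ext P
    constructor
    · intro hP
      obtain ⟨I, hI, hIP⟩ := MayrMeyer.exists_listedPrimes_le hn hd0 hd' hP.1.1 hP.1.2
      obtain ⟨i, rfl⟩ := hrange.symm ▸ hI
      have hPI := hP.2 ⟨MayrMeyer.isPrime_primeFamily hn hd' i,
        MayrMeyer.J_le_primeFamily hn hd0 hd' i⟩ hIP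
      rwa [le_antisymm hPI hIP]
    · intro hP
      obtain ⟨j, rfl⟩ := hrange.symm ▸ hP
      refine ⟨⟨MayrMeyer.isPrime_primeFamily hn hd' j,
        MayrMeyer.J_le_primeFamily hn hd0 hd' j⟩, fun Q hQ hQP ↦ ?_⟩
      -- A listed `I ≤ Q ≤ P` with `P` listed must equal `P` by incomparability, so `Q = P`.
      obtain ⟨I, hI, hIQ⟩ := MayrMeyer.exists_listedPrimes_le hn hd0 hd' hQ.1 hQ.2
      obtain ⟨i, rfl⟩ := hrange.symm ▸ hI
      rwa [← (hle i j).1 (hIQ.trans hQP)]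
  refine ⟨hmin, ?_, hanti⟩
  rw [hmin, ← hrange, ← Set.image_univ,
    Set.ncard_image_of_injective _ fun i j h ↦ (hle i j).1 h.le, Set.ncard_univ]
  exact MayrMeyer.natCard_primeIndex n (hd'.cast_ne_zero hd0)
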